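/- Conventions. For $n\ge 0$ let $\mathbb{Z}\langle\vartheta,x_1,\dots,x_n\rangle$ be the divided power polynomial ring (free abelian group on the monomials $x_0^{[N_0]}x_1^{[N_1]}\cdots x_n^{[N_n]}$, $x_0=\vartheta$, with $x_i^{[M]}x_i^{[N]}=\binom{M+N}{M}x_i^{[M+N]}$), and let $A^\bullet(\Delta^n)$ be the exterior algebra over it on $dx_1,\dots,dx_n$, with the $\mathbb{Z}\langle\vartheta\rangle$-linear differential determined by $d(x_i^{[N]})=x_i^{[N-1]}dx_i$ for $N\ge1$. An order-preserving map $\alpha:[m]\to[n]$ acts by the cochain algebra map $\alpha^*$ with $\alpha^*(x_i^{[N]})=x_{\min\{j:\alpha(j)\ge i\}}^{[N]}$, where $x_j=0$ (so $x_j^{[0]}=1$, $x_j^{[N]}=0$ for $N\ge 1$) if no such $j$ exists. A differential form on a simplicial set $X$ is a simplicial map $\omega:X\to A^\bullet(\Delta^-)$; $d$ and $\wedge$ are simplexwise, and $\omega$ is homogeneous of degree $|\omega|=p$ if all its values are $p$-forms. Fiberwise integration. Let $\Gamma:[n+r]\hookrightarrow[n]\times[r]$ be a maximal chain with components $\Gamma_b,\Gamma_f$.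 Put $b_\Gamma(i)=\min\{j:\Gamma_b(j)=i\}$, $f_\Gamma(i)=\min\{j:\Gamma_f(j)\ge i\}$ and $u_\Gamma(i)=f_\Gamma(\min\{j\in\{1,\dots,r\}: f_\Gamma(j)-j=f_\Gamma(i)-i\})-1$. Let $\int_\Gamma:A^\bullet(\Delta^{n+r})\to A^\bullet(\Delta^n)$ be the additive map with $$\int_\Gamma g\,dx_{f_\Gamma(1)}\wedge\dots\wedge dx_{f_\Gamma(r)}\wedge\Gamma_b^*\beta=b_\Gamma^*\Big(\int_{x_{f_\Gamma(r)+1}}^{x_{u_\Gamma(r)}}\!\!\cdots\int_{x_{f_\Gamma(1)+1}}^{x_{u_\Gamma(1)}}g\,dx_{f_\Gamma(1)}\cdots dx_{f_\Gamma(r)}\Big)\,\beta$$ (with $x_{n+r+1}=0$, and $\int_\alpha^\beta(\cdot)\,dx_i$ replacing $x_i^{[N]}$ by $\beta^{[N+1]}-\alpha^{[N+1]}$), vanishing on terms in which one of the $dx_{f_\Gamma(k)}$ does not occur. For a form $\omega$ on $X\times\Delta^r$, its fiberwise integral along $X\times\Delta^r\to X$ takes the value $\sum_\Gamma\int_\Gamma\Gamma^*(x\times\mathrm{id})^*\omega$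 on an $n$-simplex $x$ of $X$. Iterated integrals. Let $\phi_r:X^{\Delta^1}\times\Delta^r\to X^r$ be the map whose $j$-th component is the evaluation $\Delta^1\times X^{\Delta^1}\to X$ applied after $\Delta^r\to\Delta^1$, $i\mapsto 1$ if $i\ge j$ and $i\mapsto 0$ if $i<j$. For forms $\omega_1,\dots,\omega_r$ on $X$, $\int\omega_1\cdots\omega_r$ is the fiberwise integral of $\phi_r^*(\mathrm{pr}_1^*\omega_1\wedge\dots\wedge\mathrm{pr}_r^*\omega_r)$ along $X^{\Delta^1}\times\Delta^r\to X^{\Delta^1}$ (for $r=0$ it is $1$). Let $E_\varepsilon:X^{\Delta^1}\to X$ be the evaluation at the vertex $\varepsilon\in\{0,1\}$ of $\Delta^1$. Proposition. Let $X$ be a simplicial set, $r\ge1$, and let $\omega_1,\dots,\omega_r$ be homogeneous differential forms on $X$. Then $\int\omega_1\cdots\omega_r$ is a differential form on $X^{\Delta^1}$ and $$\begin{aligned}d\Big(\int\omega_1\cdots\omega_r\Big)={}&\sum_{i=1}^{r}(-1)^{|\omega_1|+\dots+|\omega_{i-1}|+r}\int\omega_1\cdots d\omega_i\cdots\omega_r+\sum_{i=1}^{r-1}(-1)^{r-1-i}\int\omega_1\cdots(\omega_i\wedge\omega_{i+1})\cdots\omega_r\\&+(-1)^{(r-1)(|\omega_1|-1)}E_1^*\omega_1\wedge\int\omega_2\cdots\omega_r-\Big(\int\omega_1\cdots\omega_{r-1}\Big)\wedge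 E_0^*\omega_r.\end{aligned}$$ -/

import Mathlib

open CategoryTheory MonoidalCategory Simplicial Opposite
open scoped TensorProduct

universe u

noncomputable section

namespace SimplicialForms

/-! ### Divided power polynomials -/

/-- The divided power polynomial ring `ℤ⟨x_s : s ∈ σ⟩`: the free abelian group on the divided
power monomials `x^[N] = ∏ s, x_s^[N s]`, for `N : σ →₀ ℕ`. -/
def DPPoly (σ : Type) : Type := (σ →₀ ℕ) →₀ ℤ

namespace DPPoly

variable {σ : Type}

instance instAddCommGroup : AddCommGroup (DPPoly σ) :=
  inferInstanceAs (AddCommGroup ((σ →₀ ℕ) →₀ ℤ))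

/-- The element `a • x^[N]`. -/
def monomial (N : σ →₀ ℕ) (a : ℤ) : DPPoly σ := Finsupp.single N a

/-- The additive map out of `ℤ⟨x⟩` with prescribed values `v N` on the monomials `x^[N]`. -/
def lift {M : Type} [AddCommGroup M] (v : (σ →₀ ℕ) → M) : DPPoly σ →ₗ[ℤ] M :=
  (show ((σ →₀ ℕ) →₀ ℤ) →+ M from
    Finsupp.liftAddHom fun N => (smulAddHom ℤ M).flip (v N)).toIntLinearMap

theorem lift_monomial {M : Type} [AddCommGroup M] (v : (σ →₀ ℕ) → M) (N : σ →₀ ℕ) (a : ℤ) :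
    lift v (monomial N a) = a • v N :=
  Finsupp.liftAddHom_apply_single (fun N => (smulAddHom ℤ M).flip (v N)) N a

theorem induction_on {P : DPPoly σ → Prop} (f : DPPoly σ)
    (hm : ∀ N a, P (monomial N a)) (ha : ∀ f g, P f → P g → P (f + g)) : P f :=
  Finsupp.induction_linear (motive := P) f
    (by
      have h := hm 0 0
      have h0 : (monomial 0 0 : DPPoly σ) = 0 := Finsupp.single_zero 0
      rw [h0] at h
      exact h)
    ha hm

/-- The product of the multinomial coefficients `(M s + N s)! / ((M s)! (N s)!)`. -/
def mulCoeff (M N : σ →₀ ℕ) : ℕ := (M + N).prod fun s k => k.choose (M s)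

/-- Multiplication `x^[M] x^[N] = (∏ s, (M s + N s)! / ((M s)! (N s)!)) x^[M + N]`,
extended biadditively. -/
def mulHom (σ : Type) : DPPoly σ →ₗ[ℤ] DPPoly σ →ₗ[ℤ] DPPoly σ :=
  lift fun M => lift fun N => monomial (M + N) (mulCoeff M N)

instance : Mul (DPPoly σ) := ⟨fun f g => mulHom σ f g⟩

instance : One (DPPoly σ) := ⟨monomial 0 1⟩

/-- The canonical embedding into the rational polynomial ring, `x^[N] ↦ ∏ s, x_s^(N s) / (N s)!`. -/
def toRat (σ : Type) : DPPoly σ →ₗ[ℤ] MvPolynomial σ ℚ :=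
  lift fun N => MvPolynomial.monomial N (N.prod fun _ k => (k.factorial : ℚ))⁻¹

theorem toRat_monomial (N : σ →₀ ℕ) (a : ℤ) :
    toRat σ (monomial N a) =
      MvPolynomial.monomial N ((a : ℚ) * (N.prod fun _ k => (k.factorial : ℚ))⁻¹) := by
  rw [toRat, lift_monomial, ← map_zsmul, zsmul_eq_mul]

theorem factorial_prod_ne_zero (N : σ →₀ ℕ) : (N.prod fun _ k => (k.factorial : ℚ)) ≠ 0 :=
  Finset.prod_ne_zero_iff.mpr fun _ _ => Nat.cast_ne_zero.mpr (Nat.factorial_ne_zero _)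

/-- The coefficient of `x^[N]`. -/
def coeff (N : σ →₀ ℕ) (f : DPPoly σ) : ℤ := Finsupp.toFun f N

theorem coeff_monomial [DecidableEq (σ →₀ ℕ)] (M N : σ →₀ ℕ) (a : ℤ) :
    coeff N (monomial M a) = if M = N then a else 0 := Finsupp.single_apply

theorem coeff_toRat (f : DPPoly σ) (N : σ →₀ ℕ) :
    MvPolynomial.coeff N (toRat σ f) =
      (coeff N f : ℚ) * (N.prod fun _ k => (k.factorial : ℚ))⁻¹ := by
  classical
  induction f using induction_on with
  | ha f g hf hg =>
    have h : coeff N (f + g) = coeff N f + coeff N g := Finsupp.add_apply f g N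
    rw [map_add, MvPolynomial.coeff_add, hf, hg, h]
    push_cast
    ring
  | hm M a =>
    rw [toRat_monomial, MvPolynomial.coeff_monomial, coeff_monomial]
    split_ifs with hMN
    · subst hMN; rfl
    · simp

theorem toRat_injective : Function.Injective (toRat σ) := by
  intro f g h
  refine Finsupp.ext fun N => ?_
  have h1 := congrArg (MvPolynomial.coeff N) h
  rw [coeff_toRat, coeff_toRat] at h1
  exact Int.cast_injective (mul_right_cancel₀ (inv_ne_zero (factorial_prod_ne_zero N)) h1)

theorem mulCoeff_mul (M N : σ →₀ ℕ) :
    (mulCoeff M N : ℚ) * ((M.prod fun _ k => (k.factorial : ℚ)) *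
      (N.prod fun _ k => (k.factorial : ℚ))) =
        (M + N).prod fun _ k => (k.factorial : ℚ) := by
  classical
  have hM : M.support ⊆ (M + N).support := by
    intro s; simp only [Finsupp.mem_support_iff, Finsupp.add_apply]; omega
  have hN : N.support ⊆ (M + N).support := by
    intro s; simp only [Finsupp.mem_support_iff, Finsupp.add_apply]; omega
  rw [Finsupp.prod_of_support_subset M hM _ (by simp),
    Finsupp.prod_of_support_subset N hN _ (by simp)]
  unfold mulCoeff Finsupp.prod
  push_cast
  rw [← Finset.prod_mul_distrib, ← Finset.prod_mul_distrib]
  refine Finset.prod_congr rfl fun s _ => ?_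
  have h := Nat.choose_mul_factorial_mul_factorial (Nat.le_add_right (M s) (N s))
  rw [Nat.add_sub_cancel_left, mul_assoc] at h
  change (((M s + N s).choose (M s) : ℕ) : ℚ) * _ = ((M s + N s).factorial : ℚ)
  exact_mod_cast h

theorem monomial_mul (M N : σ →₀ ℕ) (a b : ℤ) :
    monomial M a * monomial N b = monomial (M + N) (a * b * mulCoeff M N) := by
  change mulHom σ _ _ = _
  rw [mulHom, lift_monomial, LinearMap.smul_apply, lift_monomial, smul_smul]
  exact Finsupp.smul_single _ _ _

theorem add_mul' (f g h : DPPoly σ) : (f + g) * h = f * h + g * h := by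
  change mulHom σ _ _ = mulHom σ _ _ + mulHom σ _ _
  rw [map_add, LinearMap.add_apply]

theorem mul_add' (f g h : DPPoly σ) : f * (g + h) = f * g + f * h :=
  map_add (mulHom σ f) g h

theorem toRat_mul (f g : DPPoly σ) : toRat σ (f * g) = toRat σ f * toRat σ g := by
  induction f using induction_on with
  | ha f₁ f₂ h₁ h₂ => rw [add_mul', map_add, map_add, add_mul, h₁, h₂]
  | hm M a =>
    induction g using induction_on with
    | ha g₁ g₂ h₁ h₂ => rw [mul_add', map_add, map_add, mul_add, h₁, h₂]
    | hm N b =>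
      rw [monomial_mul, toRat_monomial, toRat_monomial, toRat_monomial,
        MvPolynomial.monomial_mul, ← mulCoeff_mul]
      have h1 := factorial_prod_ne_zero M
      have h2 := factorial_prod_ne_zero N
      have h3 : (mulCoeff M N : ℚ) ≠ 0 := by
        intro h0
        have := mulCoeff_mul M N
        rw [h0, zero_mul] at this
        exact factorial_prod_ne_zero _ this.symm
      congr 1
      push_cast
      field_simp

theorem toRat_one : toRat σ 1 = 1 := by
  change toRat σ (monomial 0 1) = 1
  rw [toRat_monomial]
  simp

instance instCommRing : CommRing (DPPoly σ) :=
  { instAddCommGroup with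
    mul := (· * ·)
    one := 1
    left_distrib := mul_add'
    right_distrib := add_mul'
    zero_mul := fun f => toRat_injective (by rw [toRat_mul, map_zero, zero_mul])
    mul_zero := fun f => toRat_injective (by rw [toRat_mul, map_zero, mul_zero])
    mul_assoc := fun f g h => toRat_injective (by simp only [toRat_mul, mul_assoc])
    mul_comm := fun f g => toRat_injective (by simp only [toRat_mul, mul_comm])
    one_mul := fun f => toRat_injective (by rw [toRat_mul, toRat_one, one_mul])
    mul_one := fun f => toRat_injective (by rw [toRat_mul, toRat_one, mul_one]) }

end DPPoly

/-! ### The divided power de Rham algebra of the standard simplices -/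

/-- Functions on the standard `n`-simplex: `ℤ⟨x_0, x_1, …, x_n⟩`, with `x_0 = ϑ`. -/
abbrev Fun (n : ℕ) : Type := DPPoly (Fin (n + 1))

/-- The divided power `x_k^[s]`, for an index `k : ℕ`, with the convention `x_k = 0` for
`k > n` (so that `x_k^[0] = 1` and `x_k^[s] = 0` for `s > 0`). -/
def xpow (n k s : ℕ) : Fun n :=
  if h : k < n + 1 then DPPoly.monomial (Finsupp.single ⟨k, h⟩ s) 1
  else if s = 0 then 1 else 0

/-- `min {j ∈ [m] | i ≤ α j}`, with the value `m + 1` if there is no such `j`. -/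
def pullIndex {m n : ℕ} (α : ⦋m⦌ ⟶ ⦋n⦌) (i : Fin (n + 1)) : ℕ :=
  sInf {j | ∀ h : j < m + 1, i ≤ α.toOrderHom ⟨j, h⟩}

/-- The ring map `α^*` on functions: `x_i^[N] ↦ x_{min {j | i ≤ α j}}^[N]`, which is `0` (for
`N > 0`) if there is no such `j`. -/
def pullFun {m n : ℕ} (α : ⦋m⦌ ⟶ ⦋n⦌) : Fun n →ₗ[ℤ] Fun m :=
  DPPoly.lift fun N => ∏ i, xpow m (pullIndex α i) (N i)

/-- The partial derivative: `∂/∂x_i x^[N] = x_0^[N_0] ⋯ x_i^[N_i - 1] ⋯ x_n^[N_n]`, which is `0`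
if `N_i = 0`. -/
def partialDeriv {n : ℕ} (i : Fin (n + 1)) : Fun n →ₗ[ℤ] Fun n :=
  DPPoly.lift fun N => if N i = 0 then 0 else DPPoly.monomial (N - Finsupp.single i 1) 1

/-- The free abelian group on `dx_1, …, dx_n`; the generator `dx_{i+1}` is the `i`-th standard
basis vector. -/
abbrev Diff (n : ℕ) : Type := Fin n → ℤ

/-- `dx_k` for an index `k : ℕ`; it is `0` for `k = 0` (as `x_0 = ϑ` is a constant) and for
`k > n` (as then `x_k = 0`). -/
def dx (n k : ℕ) : Diff n := fun j => if (j : ℕ) + 1 = k then 1 else 0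

/-- `α^*` on the differentials: `dx_i ↦ dx_{min {j | i ≤ α j}}`. -/
def pullDiff {m n : ℕ} (α : ⦋m⦌ ⟶ ⦋n⦌) : Diff n →ₗ[ℤ] Diff m :=
  (Pi.basisFun ℤ (Fin n)).constr ℤ fun i => dx m (pullIndex α i.succ)

/-- The divided power de Rham algebra of the standard `n`-simplex: the exterior algebra over
`ℤ⟨ϑ, x_1, …, x_n⟩` on the free module with basis `dx_1, …, dx_n`, written as
`Λ_ℤ(dx_1, …, dx_n) ⊗ ℤ⟨ϑ, x_1, …, x_n⟩`. -/
abbrev Omega (n : ℕ) : Type := ExteriorAlgebra ℤ (Diff n) ⊗[ℤ] Fun n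

/-- The pullback `α^*` of forms on standard simplices. -/
def pull {m n : ℕ} (α : ⦋m⦌ ⟶ ⦋n⦌) : Omega n →ₗ[ℤ] Omega m :=
  TensorProduct.map (ExteriorAlgebra.map (pullDiff α)).toLinearMap (pullFun α)

/-- The differential `d (w f) = ∑ i, dx_i ∧ w (∂f/∂x_i)`, for a constant form `w` and a
function `f`. -/
def dOmega (n : ℕ) : Omega n →ₗ[ℤ] Omega n :=
  ∑ i : Fin n, TensorProduct.map
    (LinearMap.mulLeft ℤ (ExteriorAlgebra.ι ℤ (dx n (i + 1)))) (partialDeriv i.succ)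

/-- The `p`-forms on the standard `n`-simplex. -/
def OmegaDeg (n p : ℕ) : Submodule ℤ (Omega n) :=
  LinearMap.range (TensorProduct.map (⋀[ℤ]^p (Diff n)).subtype
    (LinearMap.id : Fun n →ₗ[ℤ] Fun n))

/-! ### Differential forms on simplicial sets -/

/-- Families of forms `ω_x` on standard simplices, one for every simplex `x` of `X`, with the
simplexwise ring structure. The differential forms on `X` are the compatible families. -/
abbrev Family (X : SSet.{u}) : Type u := ∀ n : ℕ, X _⦋n⦌ → Omega n

/-- A family is a differential form on `X` if it is a simplicial map from `X` to the simplicial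
de Rham algebra, i.e. if `ω_{α^* x} = α^* ω_x` for all simplices `x` and all `α`. -/
def IsForm {X : SSet.{u}} (ω : Family X) : Prop :=
  ∀ (m n : ℕ) (α : ⦋m⦌ ⟶ ⦋n⦌) (x : X _⦋n⦌), ω m (X.map α.op x) = pull α (ω n x)

/-- `ω` is homogeneous of degree `p`. -/
def IsHomogeneous {X : SSet.{u}} (p : ℕ) (ω : Family X) : Prop :=
  ∀ (n : ℕ) (x : X _⦋n⦌), ω n x ∈ OmegaDeg n p

/-- The differential, simplexwise. -/
def d {X : SSet.{u}} (ω : Family X) : Family X := fun n x => dOmega n (ω n x)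

/-- The pullback of a form along a simplicial map. -/
def pullback {X Y : SSet.{u}} (f : X ⟶ Y) (ω : Family Y) : Family X :=
  fun n x => ω n (f.app (op ⦋n⦌) x)

/-! ### Fiberwise integration along `X × Δ^r → X` -/

/-- Maximal chains `Γ : [n + r] ↪ [n] × [r]`. -/
abbrev MaxChain (n r : ℕ) : Type := Fin (n + r + 1) ↪o Fin (n + 1) × Fin (r + 1)

instance instFintypeMaxChain (n r : ℕ) : Fintype (MaxChain n r) :=
  Fintype.ofInjective (fun Γ => (Γ : Fin (n + r + 1) → Fin (n + 1) × Fin (r + 1)))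
    DFunLike.coe_injective

namespace MaxChain

variable {n r : ℕ} (Γ : MaxChain n r)

/-- `Γ_b : [n + r] → [n]`, the first component of `Γ`. -/
def toBase : ⦋n + r⦌ ⟶ ⦋n⦌ :=
  SimplexCategory.Hom.mk ⟨fun j => (Γ j).1, fun _ _ h => (Γ.monotone h).1⟩

/-- `Γ_f : [n + r] → [r]`, the second component of `Γ`. -/
def toFiber : ⦋n + r⦌ ⟶ ⦋r⦌ :=
  SimplexCategory.Hom.mk ⟨fun j => (Γ j).2, fun _ _ h => (Γ.monotone h).2⟩

/-- `b_Γ : [n] → [n + r]`, `b_Γ(i) = min {j | i ≤ Γ_b(j)}`. As `Γ_b` is monotone and surjective,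
this is also `min {j | Γ_b(j) = i}`. -/
def base : ⦋n⦌ ⟶ ⦋n + r⦌ :=
  SimplexCategory.Hom.mk
    ⟨fun i => sInf {j | i ≤ (Γ j).1},
      fun _ _ h => sInf_le_sInf fun _ hj => le_trans h hj⟩

/-- `f_Γ : [r] → [n + r]`, `f_Γ(i) = min {j | i ≤ Γ_f(j)}`. -/
def fiber (i : Fin (r + 1)) : Fin (n + r + 1) := sInf {j | i ≤ (Γ j).2}

/-- `u_Γ(i) = f_Γ(min {j ∈ {1, …, r} | f_Γ(j) - j = f_Γ(i) - i}) - 1`. -/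
def upper (i : Fin (r + 1)) : ℕ :=
  (Γ.fiber (sInf {j | 1 ≤ (j : ℕ) ∧
    ((Γ.fiber j : ℕ) : ℤ) - (j : ℕ) = ((Γ.fiber i : ℕ) : ℤ) - (i : ℕ)}) : ℕ) - 1

end MaxChain

/-- `∫_{x_a}^{x_b} (·) dx_i`, which sends `x^[N]` to
`x_0^[N_0] ⋯ (x_b^[N_i + 1] - x_a^[N_i + 1]) ⋯ x_n^[N_n]`. -/
def integrateVar {n : ℕ} (i : Fin (n + 1)) (a b : ℕ) : Fun n →ₗ[ℤ] Fun n :=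
  DPPoly.lift fun N =>
    DPPoly.monomial (N.erase i) 1 * (xpow n b (N i + 1) - xpow n a (N i + 1))

/-- The composite `T_{r} ∘ ⋯ ∘ T_{1}` of a list `T_1, …, T_r` of endomorphisms. -/
def composeList {M : Type} [AddCommGroup M] {r : ℕ} (T : Fin r → Module.End ℤ M) :
    Module.End ℤ M :=
  (List.ofFn T).reverse.prod

namespace MaxChain

variable {n r : ℕ} (Γ : MaxChain n r)

/-- The iterated integral of a function over the fiber variables,
`∫_{x_{f(r)+1}}^{x_{u(r)}} ⋯ ∫_{x_{f(1)+1}}^{x_{u(1)}} (·) dx_{f(1)} ⋯ dx_{f(r)}`,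
the variable `x_{f(1)}` being integrated first; here `x_0 = ϑ` and `x_{n+r+1} = 0`. -/
def integrateFun : Fun (n + r) →ₗ[ℤ] Fun (n + r) :=
  composeList fun k : Fin r =>
    integrateVar (Γ.fiber k.succ) ((Γ.fiber k.succ : ℕ) + 1) (Γ.upper k.succ)

/-- The coefficient of `dx_{f(1)} ∧ ⋯ ∧ dx_{f(r)}` in a constant form, that differential being
moved to the left:
`dx_{f(1)} ∧ ⋯ ∧ dx_{f(r)} ∧ w ↦ w` for products `w` of base differentials `dx_{b(i)}`, and every
product of differentials in which one of the `dx_{f(k)}` is missing goes to `0`. -/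
def fiberCoeff : ExteriorAlgebra ℤ (Diff (n + r)) →ₗ[ℤ] ExteriorAlgebra ℤ (Diff (n + r)) :=
  composeList fun k : Fin r =>
    CliffordAlgebra.contractLeft (Q := (0 : QuadraticForm ℤ (Diff (n + r))))
      (∑ j : Fin (n + r), (dx (n + r) (Γ.fiber k.succ) j) • LinearMap.proj j)

/-- The integral of a form on `Δ^{n+r}` over the fibers of `Γ_b`:
`∫ (f dx_{f(1)} ∧ ⋯ ∧ dx_{f(r)} ∧ Γ_b^* β) = b_Γ^*(∫ f dx_{f(1)} ⋯ dx_{f(r)}) β`,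
and the forms of lower degree in the fiber differentials have integral `0`.
Note that `b_Γ^* Γ_b^* β = β`. -/
def integrate : Omega (n + r) →ₗ[ℤ] Omega n :=
  pull Γ.base ∘ₗ TensorProduct.map Γ.fiberCoeff Γ.integrateFun

end MaxChain

/-- The restriction of a family on `X × Δ^r` along `Γ : Δ^{n+r} → Δ^n × Δ^r` and
`x × id : Δ^n × Δ^r → X × Δ^r`, for an `n`-simplex `x` of `X`. -/
def restrict {X : SSet.{u}} {r : ℕ} (ω : Family (X ⊗ Δ[r])) {n : ℕ} (x : X _⦋n⦌)
    (Γ : MaxChain n r) : Omega (n + r) :=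
  ω (n + r) ((X.map Γ.toBase.op x, SSet.stdSimplex.objEquiv.symm Γ.toFiber) :
    X _⦋n + r⦌ × (Δ[r] : SSet.{u}) _⦋n + r⦌)

/-- Fiberwise integration along the projection `X × Δ^r → X`. -/
def fiberIntegral {X : SSet.{u}} (r : ℕ) (ω : Family (X ⊗ Δ[r])) : Family X :=
  fun _ x => ∑ Γ : MaxChain _ r, Γ.integrate (restrict ω x Γ)

/-! ### Iterated integrals -/

/-- The path simplicial set `X^{Δ^1}`. -/
abbrev pathSpace (X : SSet.{u}) : SSet.{u} := (ihom (Δ[1] : SSet.{u})).obj X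

/-- The `j`-th component `[r] → [1]` of the map `[r] → [1]^r`, `i ↦ (1, …, 1, 0, …, 0)` with `i`
ones, for `j = 1, …, r`; in terms of the index `j - 1 : Fin r`. -/
def iotaHom {r : ℕ} (j : Fin r) : ⦋r⦌ ⟶ ⦋1⦌ :=
  SimplexCategory.Hom.mk ⟨fun i : Fin (r + 1) => if (j : ℕ) < i then (1 : Fin 2) else 0, by
    intro a b h
    have h' : (a : ℕ) ≤ b := h
    by_cases ha : (j : ℕ) < a
    · have hb : (j : ℕ) < b := lt_of_lt_of_le ha h'
      simp [ha, hb]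
    · simp [ha]⟩

/-- The `j`-th component `X^{Δ^1} × Δ^r → Δ^1 × X^{Δ^1} → X` of
`φ_r : X^{Δ^1} × Δ^r → (X^{Δ^1})^r × (Δ^1)^r ≅ (Δ^1 × X^{Δ^1})^r → X^r`. -/
def phi (X : SSet.{u}) {r : ℕ} (j : Fin r) : pathSpace X ⊗ (Δ[r] : SSet.{u}) ⟶ X :=
  CartesianMonoidalCategory.lift
      (CartesianMonoidalCategory.snd _ _ ≫ SSet.stdSimplex.map (iotaHom j))
      (CartesianMonoidalCategory.fst _ _) ≫
    (ihom.ev (Δ[1] : SSet.{u})).app X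

/-- The form `ω_1 × ⋯ × ω_r` on `X^{Δ^1} × Δ^r`, the pullback of
`pr_1^* ω_1 ∧ ⋯ ∧ pr_r^* ω_r` along `φ_r`. -/
def timesForm {X : SSet.{u}} {r : ℕ} (ω : Fin r → Family X) :
    Family (pathSpace X ⊗ (Δ[r] : SSet.{u})) :=
  (List.ofFn fun j : Fin r => pullback (phi X j) (ω j)).prod

/-- The iterated integral `∫ ω_1 ⋯ ω_r` on the path simplicial set. -/
def iteratedIntegral {X : SSet.{u}} {r : ℕ} (ω : Fin r → Family X) : Family (pathSpace X) :=
  fiberIntegral r (timesForm ω)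

/-- The evaluation `E_ε : X^{Δ^1} → X^{Δ{ε}} ≅ Δ^0 × X^{Δ^0} → X` at the vertex `ε` of `Δ^1`. -/
def evalAt (X : SSet.{u}) (ε : Fin 2) : pathSpace X ⟶ X :=
  (MonoidalClosed.pre (SSet.stdSimplex.{u}.map (SimplexCategory.const ⦋0⦌ ⦋1⦌ ε))).app X ≫
    CartesianMonoidalCategory.lift (SSet.stdSimplex.isTerminalObj₀.from _) (𝟙 _) ≫
      (ihom.ev (Δ[0] : SSet.{u})).app X

end SimplicialForms

end

/-!
The proof integrates over one fiber variable at a time.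

Write `y = x_{i+1}`. The degeneracy `σ_i` forgets `y`, and every form on the `(n + 1)`-simplex is a
sum of forms `σ_i^* η · y^[s]` and `dy ∧ σ_i^* η · y^[s]` with `η` a form on the `n`-simplex
(`omega_induction`). Integration along `y` from `x_{i+2}` to `x_i` is a map `fiberStep i` to forms on
the `n`-simplex, determined by `σ_i^* η · y^[s] ↦ 0` and
`dy ∧ σ_i^* η · y^[s] ↦ η · (x_i^[s+1] - x_{i+1}^[s+1])`. On these generators one reads off that it
is a chain homotopy between the restrictions to the two faces that are sections of `σ_i`
(`dOmega_fiberStep`), and that for every `β : [m] → [n]` the form `β^* (fiberStep i ω)` is the sum of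
`fiberStep i'` over the vertices `i'` with `β i' = i`, applied to the pullback of `ω` along the map
in which `i'` and `i` are doubled (`pull_fiberStep`, a telescoping sum).

For a form `ω` on `X × Δ^{r+1}`, integrating over the first fiber variable `t_1`, from `t_2` to `ϑ`,
gives a family `fiberPart ω` on `X × Δ^r`: on the simplex `(x, α)` it is the sum of the `fiberStep i`
over the vertices `i` with `α i = 0`. By the two facts above it is again a form
(`IsForm.fiberPart`), and its differential is the telescoping sum
`d_0^* ω - d_1^* ω - fiberPart (d ω)` (`d_fiberPart`).

A maximal chain in `[n] × [r + 1]` is a maximal chain in `[n] × [r]` together with a vertex `i` of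
the bottom row that gets doubled, and integration along the first chain is `fiberStep i` followed by
integration along the second one (`MaxChain.integrate_insertStep`). Hence fiberwise integration over
`Δ^{r+1}` is `fiberPart` followed by fiberwise integration over `Δ^r` (`fiberIntegral_succ`), and by
induction on `r` fiberwise integrals of forms are forms, Stokes' formula `d_fiberIntegral` holds, and
forms pulled back from the base can be moved out of the integral (`fiberIntegral_mul_pullback`,
`fiberIntegral_pullback_mul`).

The theorem is Stokes' formula for `ω_1 × ⋯ × ω_r`. The Leibniz rule gives the first sum, and the
restriction of this form to the `s`-th face of `Δ^r` replaces `ω_s, ω_{s+1}` by their product for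
`0 < s < r`; for `s = 0` and `s = r` it evaluates the first form at the end point and the last form at
the starting point of the path (`facePull_castSucc_succ_timesForm`, `facePull_zero_timesForm`,
`facePull_last_timesForm`).
-/

open CategoryTheory MonoidalCategory Simplicial Opposite
open scoped TensorProduct

noncomputable section

namespace SimplicialForms

/-! ### Pullback of indices -/

/-- The least `j` with `k ≤ α j`, and `m + 1` if there is none: the function `pullIndex`, extended
to all natural numbers `k`. -/
def leastIndex {m n : ℕ} (α : ⦋m⦌ ⟶ ⦋n⦌) (k : ℕ) : ℕ :=
  sInf {j | ∀ h : j < m + 1, k ≤ (α.toOrderHom ⟨j, h⟩ : ℕ)}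

section leastIndex

variable {l m n : ℕ}

theorem leastIndex_le (α : ⦋m⦌ ⟶ ⦋n⦌) (k : ℕ) : leastIndex α k ≤ m + 1 :=
  Nat.sInf_le fun h => absurd h (lt_irrefl _)

/-- The Galois connection between `leastIndex α` and `α`. -/
theorem leastIndex_le_iff (α : ⦋m⦌ ⟶ ⦋n⦌) (k : ℕ) (j : Fin (m + 1)) :
    leastIndex α k ≤ j ↔ k ≤ (α.toOrderHom j : ℕ) := by
  constructor
  · intro h
    have hmem : leastIndex α k ∈ {j | ∀ h : j < m + 1, k ≤ (α.toOrderHom ⟨j, h⟩ : ℕ)} :=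
      Nat.sInf_mem ⟨m + 1, fun h => absurd h (lt_irrefl _)⟩
    have hlt : leastIndex α k < m + 1 := lt_of_le_of_lt h j.2
    exact (hmem hlt).trans (α.toOrderHom.monotone (show (⟨_, hlt⟩ : Fin (m + 1)) ≤ j from h))
  · intro h
    exact Nat.sInf_le fun _ => h

theorem leastIndex_eq (α : ⦋m⦌ ⟶ ⦋n⦌) (k a : ℕ) (ha : a ≤ m + 1)
    (h : ∀ j : Fin (m + 1), a ≤ j ↔ k ≤ (α.toOrderHom j : ℕ)) : leastIndex α k = a := by
  have hb := leastIndex_le α k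
  rcases lt_trichotomy (leastIndex α k) a with hlt | heq | hlt
  · have := (h ⟨leastIndex α k, by omega⟩).2 ((leastIndex_le_iff α k ⟨_, by omega⟩).1 le_rfl)
    simp only at this; omega
  · exact heq
  · have := (leastIndex_le_iff α k ⟨a, by omega⟩).2 ((h ⟨a, by omega⟩).1 le_rfl)
    simp only at this; omega

theorem leastIndex_of_gt (α : ⦋m⦌ ⟶ ⦋n⦌) (k : ℕ) (hk : n < k) : leastIndex α k = m + 1 := by
  refine leastIndex_eq α k _ le_rfl fun j => ?_
  have h1 : ((α.toOrderHom j : Fin (n + 1)) : ℕ) < n + 1 := (α.toOrderHom j).2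
  have h2 := j.2
  omega

theorem leastIndex_zero (α : ⦋m⦌ ⟶ ⦋n⦌) : leastIndex α 0 = 0 :=
  leastIndex_eq α 0 0 (by omega) fun j => by simp

theorem leastIndex_mono (α : ⦋m⦌ ⟶ ⦋n⦌) : Monotone (leastIndex α) := by
  intro a b h
  by_cases hb : leastIndex α b < m + 1
  · exact (leastIndex_le_iff α a ⟨_, hb⟩).2 (h.trans ((leastIndex_le_iff α b ⟨_, hb⟩).1 le_rfl))
  · have := leastIndex_le α a
    omega

theorem leastIndex_comp (α : ⦋l⦌ ⟶ ⦋m⦌) (β : ⦋m⦌ ⟶ ⦋n⦌) (k : ℕ) :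
    leastIndex (α ≫ β) k = leastIndex α (leastIndex β k) := by
  refine leastIndex_eq _ _ _ (leastIndex_le _ _) fun j => ?_
  rw [leastIndex_le_iff, leastIndex_le_iff]
  rfl

theorem leastIndex_id (k : ℕ) (hk : k ≤ n + 1) : leastIndex (𝟙 ⦋n⦌) k = k :=
  leastIndex_eq _ _ _ hk fun _ => Iff.rfl

theorem σ_apply (i : Fin (n + 1)) (j : Fin (n + 2)) :
    (((SimplexCategory.σ i).toOrderHom j : Fin (n + 1)) : ℕ) =
      if (j : ℕ) ≤ i then (j : ℕ) else (j : ℕ) - 1 := by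
  change ((Fin.predAbove i j : Fin (n + 1)) : ℕ) = _
  by_cases h : (j : ℕ) ≤ i
  · rw [if_pos h, Fin.predAbove_of_le_castSucc _ _ (by exact h)]
    rfl
  · rw [if_neg h, Fin.predAbove_of_castSucc_lt _ _ (by simpa [Fin.lt_def] using h)]
    rfl

theorem δ_apply (i : Fin (n + 2)) (j : Fin (n + 1)) :
    (((SimplexCategory.δ i).toOrderHom j : Fin (n + 2)) : ℕ) =
      if (j : ℕ) < i then (j : ℕ) else (j : ℕ) + 1 := by
  change ((Fin.succAbove i j : Fin (n + 2)) : ℕ) = _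
  unfold Fin.succAbove
  split_ifs with h1 h2 h2 <;> simp_all [Fin.lt_def]

theorem leastIndex_σ (i : Fin (n + 1)) (k : ℕ) (hk : k ≤ n + 1) :
    leastIndex (SimplexCategory.σ i) k = if k ≤ i then k else k + 1 := by
  refine leastIndex_eq _ _ _ (by split_ifs <;> omega) fun j => ?_
  rw [σ_apply]
  split_ifs <;> omega

theorem leastIndex_δ (i : Fin (n + 2)) (k : ℕ) (hk : k ≤ n + 2) :
    leastIndex (SimplexCategory.δ i) k = if k ≤ i then k else k - 1 := by
  refine leastIndex_eq _ _ _ (by split_ifs <;> omega) fun j => ?_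
  rw [δ_apply]
  split_ifs <;> omega

end leastIndex

/-! ### Divided powers and their pullbacks -/

section Functions

variable {l m n : ℕ}

theorem xpow_of_le {k : ℕ} (h : k < n + 1) (s : ℕ) :
    xpow n k s = DPPoly.monomial (Finsupp.single ⟨k, h⟩ s) 1 := dif_pos h

theorem xpow_of_gt {k : ℕ} (h : n < k) (s : ℕ) : xpow n k s = if s = 0 then 1 else 0 :=
  dif_neg (by omega)

@[simp] theorem xpow_zero (k : ℕ) : xpow n k 0 = 1 := by
  by_cases h : k < n + 1
  · rw [xpow_of_le h, Finsupp.single_zero]; rfl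
  · rw [xpow_of_gt (by omega), if_pos rfl]

theorem mulCoeff_eq (M N : Fin (n + 1) →₀ ℕ) :
    DPPoly.mulCoeff M N = ∏ i, (M i + N i).choose (M i) := by
  refine Finset.prod_subset (Finset.subset_univ _) fun i _ hi => ?_
  have h : M i + N i = 0 := by simpa using hi
  change (M i + N i).choose (M i) = 1
  rw [h, show M i = 0 by omega, Nat.choose_zero_right]

theorem xpow_mul (k a b : ℕ) :
    xpow n k a * xpow n k b = ((a + b).choose a : ℤ) • xpow n k (a + b) := by
  by_cases h : k < n + 1
  · rw [xpow_of_le h, xpow_of_le h, xpow_of_le h, DPPoly.monomial_mul, ← Finsupp.single_add]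
    have : DPPoly.mulCoeff (Finsupp.single (⟨k, h⟩ : Fin (n + 1)) a) (Finsupp.single ⟨k, h⟩ b) =
        (a + b).choose a := by
      rw [mulCoeff_eq, Finset.prod_eq_single ⟨k, h⟩]
      · simp
      · intro b _ hb
        rw [Finsupp.single_eq_of_ne (by simpa using hb), Nat.choose_zero_right]
      · simp
    rw [this]
    refine Eq.symm ((Finsupp.smul_single _ _ _).trans ?_)
    simp [DPPoly.monomial]
  · rw [xpow_of_gt (by omega), xpow_of_gt (by omega), xpow_of_gt (by omega)]
    split_ifs <;> simp_all

theorem toRat_monomial_one (N : Fin (n + 1) →₀ ℕ) :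
    DPPoly.toRat _ (DPPoly.monomial N 1) =
      ∏ i, MvPolynomial.monomial (Finsupp.single i (N i)) (((N i).factorial : ℚ))⁻¹ := by
  rw [DPPoly.toRat_monomial, Int.cast_one, one_mul, Finsupp.prod_fintype _ _ (by simp),
    ← Finset.prod_inv_distrib, ← MvPolynomial.monomial_sum_prod, Finsupp.univ_sum_single]

theorem toRat_prod {ι : Type} (s : Finset ι) (f : ι → Fun n) :
    DPPoly.toRat _ (∏ i ∈ s, f i) = ∏ i ∈ s, DPPoly.toRat _ (f i) := by
  classical
  induction s using Finset.induction_on with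
  | empty => rw [Finset.prod_empty, Finset.prod_empty, DPPoly.toRat_one]
  | insert a s ha ih => rw [Finset.prod_insert ha, Finset.prod_insert ha, DPPoly.toRat_mul, ih]

theorem monomial_eq_prod (N : Fin (n + 1) →₀ ℕ) :
    (DPPoly.monomial N 1 : Fun n) = ∏ i : Fin (n + 1), xpow n i (N i) := by
  apply DPPoly.toRat_injective
  rw [toRat_prod, toRat_monomial_one]
  refine Finset.prod_congr rfl fun i _ => ?_
  rw [xpow_of_le i.2, DPPoly.toRat_monomial]
  congr 1
  rw [Finsupp.prod_single_index (by simp)]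
  simp

theorem monomial_eq_smul {σ : Type} (N : σ →₀ ℕ) (a : ℤ) :
    DPPoly.monomial N a = a • DPPoly.monomial N 1 := by
  refine Eq.symm ((Finsupp.smul_single _ _ _).trans ?_)
  simp [DPPoly.monomial]

/-- Additive maps on `ℤ⟨x_0, …, x_n⟩` agree if they agree on the monomials. -/
theorem fun_hom_ext {M : Type} [AddCommGroup M] {f g : Fun n →ₗ[ℤ] M}
    (h : ∀ N, f (DPPoly.monomial N 1) = g (DPPoly.monomial N 1)) : f = g := by
  ext x
  induction x using DPPoly.induction_on with
  | hm N a => rw [monomial_eq_smul, map_smul, map_smul, h]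
  | ha x y hx hy => rw [map_add, map_add, hx, hy]

theorem pullFun_monomial (α : ⦋m⦌ ⟶ ⦋n⦌) (N : Fin (n + 1) →₀ ℕ) :
    pullFun α (DPPoly.monomial N 1) = ∏ i : Fin (n + 1), xpow m (leastIndex α i) (N i) := by
  rw [pullFun, DPPoly.lift_monomial, one_smul]
  rfl

theorem pullFun_xpow (α : ⦋m⦌ ⟶ ⦋n⦌) (k s : ℕ) :
    pullFun α (xpow n k s) = xpow m (leastIndex α k) s := by
  by_cases h : k < n + 1
  · rw [xpow_of_le h, pullFun_monomial, Finset.prod_eq_single ⟨k, h⟩]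
    · simp
    · intro b _ hb
      rw [Finsupp.single_eq_of_ne (by simpa using hb), xpow_zero]
    · simp
  · rw [xpow_of_gt (by omega), leastIndex_of_gt _ _ (by omega), xpow_of_gt (by omega)]
    split_ifs
    · exact (pullFun_monomial α 0).trans (by simp)
    · simp

theorem pullFun_one (α : ⦋m⦌ ⟶ ⦋n⦌) : pullFun α 1 = 1 :=
  (pullFun_monomial α 0).trans (by simp)

theorem pullFun_mul (α : ⦋m⦌ ⟶ ⦋n⦌) (f g : Fun n) :
    pullFun α (f * g) = pullFun α f * pullFun α g := by
  induction f using DPPoly.induction_on with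
  | ha f₁ f₂ h₁ h₂ => rw [add_mul, map_add, map_add, add_mul, h₁, h₂]
  | hm M a =>
    induction g using DPPoly.induction_on with
    | ha g₁ g₂ h₁ h₂ => rw [mul_add, map_add, map_add, mul_add, h₁, h₂]
    | hm N b =>
      rw [DPPoly.monomial_mul, monomial_eq_smul (M + N), monomial_eq_smul M, monomial_eq_smul N,
        map_smul, map_smul, map_smul, smul_mul_smul_comm, mul_smul (a * b), pullFun_monomial,
        pullFun_monomial, pullFun_monomial, ← Finset.prod_mul_distrib]
      simp_rw [xpow_mul, Finset.prod_smul]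
      rw [mulCoeff_eq]
      push_cast
      rfl

/-- `α^*` as a homomorphism of rings. -/
def pullFunAlg (α : ⦋m⦌ ⟶ ⦋n⦌) : Fun n →ₐ[ℤ] Fun m :=
  AlgHom.ofLinearMap (pullFun α) (pullFun_one α) (pullFun_mul α)

theorem pullFun_comp (α : ⦋l⦌ ⟶ ⦋m⦌) (β : ⦋m⦌ ⟶ ⦋n⦌) (f : Fun n) :
    pullFun (α ≫ β) f = pullFun α (pullFun β f) := by
  change pullFun (α ≫ β) f = (pullFun α ∘ₗ pullFun β) f
  congr 1
  refine fun_hom_ext fun N => ?_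
  change _ = pullFunAlg α (pullFun β _)
  rw [pullFun_monomial, pullFun_monomial, map_prod]
  refine Finset.prod_congr rfl fun i _ => ?_
  rw [leastIndex_comp]
  exact (pullFun_xpow _ _ _).symm

theorem pullFun_id (f : Fun n) : pullFun (𝟙 ⦋n⦌) f = f := by
  change _ = (LinearMap.id : Fun n →ₗ[ℤ] Fun n) f
  congr 1
  refine fun_hom_ext fun N => ?_
  rw [pullFun_monomial, LinearMap.id_apply, monomial_eq_prod]
  exact Finset.prod_congr rfl fun i _ => by rw [leastIndex_id _ (by omega)]

theorem toRat_partialDeriv (i : Fin (n + 1)) (f : Fun n) :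
    DPPoly.toRat _ (partialDeriv i f) = MvPolynomial.pderiv i (DPPoly.toRat _ f) := by
  induction f using DPPoly.induction_on with
  | ha f₁ f₂ h₁ h₂ => simp only [map_add, h₁, h₂]
  | hm N a =>
    rw [monomial_eq_smul, map_smul, map_smul, map_smul, map_zsmul]
    congr 1
    rw [partialDeriv, DPPoly.lift_monomial, one_smul, DPPoly.toRat_monomial,
      MvPolynomial.pderiv_monomial]
    split_ifs with h
    · simp [h]
    · rw [DPPoly.toRat_monomial]
      congr 1
      obtain ⟨k, hk⟩ := Nat.exists_eq_succ_of_ne_zero h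
      rw [Int.cast_one, one_mul, one_mul, Finsupp.prod_fintype _ _ (by simp),
        Finsupp.prod_fintype _ _ (by simp), Fin.prod_univ_succAbove _ i,
        Fin.prod_univ_succAbove _ i]
      have h1 : ∀ j, (N - Finsupp.single i 1 : Fin (n + 1) →₀ ℕ) (i.succAbove j) =
          N (i.succAbove j) := fun j => by
        simp [Finsupp.single_eq_of_ne (Fin.succAbove_ne i j)]
      simp_rw [h1]
      rw [Finsupp.tsub_apply, hk, Finsupp.single_eq_same, Nat.succ_sub_one, Nat.factorial_succ]
      have h2 : ((∏ j, ((N (i.succAbove j)).factorial : ℚ)) : ℚ) ≠ 0 :=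
        Finset.prod_ne_zero_iff.2 fun _ _ => Nat.cast_ne_zero.2 (Nat.factorial_ne_zero _)
      have h3 : (k.factorial : ℚ) ≠ 0 := Nat.cast_ne_zero.2 (Nat.factorial_ne_zero _)
      push_cast
      field_simp

theorem partialDeriv_mul (i : Fin (n + 1)) (f g : Fun n) :
    partialDeriv i (f * g) = partialDeriv i f * g + f * partialDeriv i g := by
  apply DPPoly.toRat_injective
  rw [toRat_partialDeriv, DPPoly.toRat_mul, Derivation.leibniz, map_add, DPPoly.toRat_mul,
    DPPoly.toRat_mul, toRat_partialDeriv, toRat_partialDeriv, smul_eq_mul, smul_eq_mul]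
  ring

theorem partialDeriv_monomial (i : Fin (n + 1)) (N : Fin (n + 1) →₀ ℕ) :
    partialDeriv i (DPPoly.monomial N 1) =
      if N i = 0 then 0 else DPPoly.monomial (N - Finsupp.single i 1) 1 := by
  rw [partialDeriv, DPPoly.lift_monomial, one_smul]

theorem partialDeriv_xpow_succ (i : Fin (n + 1)) (k s : ℕ) :
    partialDeriv i (xpow n k (s + 1)) = if (i : ℕ) = k then xpow n k s else 0 := by
  by_cases h : k < n + 1
  · rw [xpow_of_le h, xpow_of_le h, partialDeriv_monomial]
    by_cases hik : (i : ℕ) = k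
    · have : i = ⟨k, h⟩ := Fin.ext hik
      subst this
      simp
    · rw [if_neg hik, Finsupp.single_eq_of_ne (by intro hh; exact hik (congrArg Fin.val hh)),
        if_pos rfl]
  · rw [xpow_of_gt (by omega), if_neg (by omega), map_zero, if_neg (by omega)]

theorem partialDeriv_one (i : Fin (n + 1)) : partialDeriv i (1 : Fun n) = 0 :=
  (partialDeriv_monomial i 0).trans (by simp)

/-- The degeneracy `σ_i^*` renames the variables, leaving out `x_{i+1}`. -/
theorem pullFun_σ_monomial (i : Fin (n + 1)) (N : Fin (n + 1) →₀ ℕ) :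
    pullFun (SimplexCategory.σ i) (DPPoly.monomial N 1) =
      DPPoly.monomial (N.embDomain i.succ.succAboveEmb) 1 := by
  rw [pullFun_monomial, monomial_eq_prod, Fin.prod_univ_succAbove _ i.succ,
    Finsupp.embDomain_of_notMem_range _ _ _ (by simp), xpow_zero, one_mul]
  refine Finset.prod_congr rfl fun j _ => ?_
  have h : N.embDomain i.succ.succAboveEmb (i.succ.succAbove j) = N j :=
    Finsupp.embDomain_apply_self _ _ _
  rw [h, leastIndex_σ _ _ (by omega)]
  congr 1
  refine Eq.trans ?_ (δ_apply i.succ j).symm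
  rw [Fin.val_succ]
  split_ifs <;> omega

end Functions

/-! ### Splitting off one variable -/

section SplitFun

variable {m n : ℕ}

theorem val_succ_succAbove (i : Fin (n + 1)) (j : Fin (n + 1)) :
    (i.succ.succAbove j : ℕ) = if (j : ℕ) ≤ i then (j : ℕ) else j + 1 := by
  refine (δ_apply i.succ j).trans ?_
  rw [Fin.val_succ]
  split_ifs <;> omega

theorem pullFun_σ_mul_xpow (i : Fin (n + 1)) (N : Fin (n + 1) →₀ ℕ) (s : ℕ) :
    pullFun (SimplexCategory.σ i) (DPPoly.monomial N 1) * xpow (n + 1) (i + 1) s =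
      DPPoly.monomial (N.embDomain i.succ.succAboveEmb + Finsupp.single i.succ s) 1 := by
  have h0 : N.embDomain i.succ.succAboveEmb i.succ = 0 :=
    Finsupp.embDomain_of_notMem_range _ _ _ (by simp)
  rw [pullFun_σ_monomial, monomial_eq_prod, monomial_eq_prod, Fin.prod_univ_succAbove _ i.succ,
    Fin.prod_univ_succAbove _ i.succ, Finsupp.add_apply, h0, xpow_zero, one_mul, zero_add,
    Finsupp.single_eq_same, mul_comm]
  refine congrArg₂ _ rfl (Finset.prod_congr rfl fun j _ => ?_)
  rw [Finsupp.add_apply, Finsupp.single_eq_of_ne (Fin.succAbove_ne _ _), add_zero]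

/-- The functions `σ_i^* h · x_{i+1}^[s]` generate `ℤ⟨x_0, …, x_{n+1}⟩`. -/
theorem fun_induction (i : Fin (n + 1)) {P : Fun (n + 1) → Prop} (f : Fun (n + 1))
    (hm : ∀ h s, P (pullFun (SimplexCategory.σ i) h * xpow (n + 1) (i + 1) s))
    (ha : ∀ f g, P f → P g → P (f + g)) : P f := by
  induction f using DPPoly.induction_on with
  | ha f g hf hg => exact ha f g hf hg
  | hm N a =>
    have key : pullFun (SimplexCategory.σ i)
        (a • DPPoly.monomial (N.comapDomain i.succ.succAbove
          Fin.succAbove_right_injective.injOn) 1) * xpow (n + 1) (i + 1) (N i.succ) =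
        DPPoly.monomial N a := by
      rw [map_smul, smul_mul_assoc, pullFun_σ_mul_xpow, monomial_eq_smul N]
      congr 2
      ext j
      rw [Finsupp.add_apply]
      rcases Fin.eq_self_or_eq_succAbove i.succ j with rfl | ⟨j, rfl⟩
      · rw [Finsupp.embDomain_of_notMem_range _ _ _ (by simp), Finsupp.single_eq_same, zero_add]
      · rw [Finsupp.single_eq_of_ne (Fin.succAbove_ne _ _), add_zero]
        exact Finsupp.embDomain_apply_self i.succ.succAboveEmb _ j
    rw [← key]
    exact hm _ _

theorem partialDeriv_pullFun_σ_self (i : Fin (n + 1)) (h : Fun n) :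
    partialDeriv i.succ (pullFun (SimplexCategory.σ i) h) = 0 := by
  change (partialDeriv i.succ ∘ₗ pullFun (SimplexCategory.σ i)) h = (0 : Fun n →ₗ[ℤ] _) h
  congr 1
  refine fun_hom_ext fun N => ?_
  rw [LinearMap.comp_apply, pullFun_σ_monomial, partialDeriv_monomial,
    if_pos (Finsupp.embDomain_of_notMem_range _ _ _ (by simp))]
  rfl

theorem partialDeriv_pullFun_σ (i l : Fin (n + 1)) (h : Fun n) :
    partialDeriv (i.succ.succAbove l) (pullFun (SimplexCategory.σ i) h) =
      pullFun (SimplexCategory.σ i) (partialDeriv l h) := by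
  change (partialDeriv (i.succ.succAbove l) ∘ₗ pullFun (SimplexCategory.σ i)) h =
    (pullFun (SimplexCategory.σ i) ∘ₗ partialDeriv l) h
  congr 1
  refine fun_hom_ext fun N => ?_
  have h0 : N.embDomain i.succ.succAboveEmb (i.succ.succAbove l) = N l :=
    Finsupp.embDomain_apply_self i.succ.succAboveEmb _ l
  rw [LinearMap.comp_apply, LinearMap.comp_apply, pullFun_σ_monomial, partialDeriv_monomial,
    partialDeriv_monomial, h0]
  split_ifs
  · rw [map_zero]
  · rw [pullFun_σ_monomial]
    congr 1
    ext j
    rw [Finsupp.tsub_apply]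
    rcases Fin.eq_self_or_eq_succAbove i.succ j with rfl | ⟨j, rfl⟩
    · rw [Finsupp.embDomain_of_notMem_range _ _ _ (by simp),
        Finsupp.embDomain_of_notMem_range _ _ _ (by simp), Nat.zero_sub]
    · have h1 := Finsupp.embDomain_apply_self i.succ.succAboveEmb N j
      have h2 := Finsupp.embDomain_apply_self i.succ.succAboveEmb (N - Finsupp.single l 1) j
      rw [Fin.succAboveEmb_apply] at h1 h2
      rw [h1, h2, Finsupp.tsub_apply]
      simp only [Finsupp.single_apply, Fin.succAbove_right_inj]

theorem integrateVar_mul_xpow (i : Fin (n + 1)) (a b : ℕ) (h : Fun n) (s : ℕ) :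
    integrateVar i.succ a b (pullFun (SimplexCategory.σ i) h * xpow (n + 1) (i + 1) s) =
      pullFun (SimplexCategory.σ i) h * (xpow (n + 1) b (s + 1) - xpow (n + 1) a (s + 1)) := by
  change (integrateVar i.succ a b ∘ₗ (LinearMap.mulRight ℤ (xpow (n + 1) (i + 1) s)) ∘ₗ
      pullFun (SimplexCategory.σ i)) h =
    ((LinearMap.mulRight ℤ (xpow (n + 1) b (s + 1) - xpow (n + 1) a (s + 1))) ∘ₗ
      pullFun (SimplexCategory.σ i)) h
  congr 1
  refine fun_hom_ext fun N => ?_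
  have h0 : N.embDomain i.succ.succAboveEmb i.succ = 0 :=
    Finsupp.embDomain_of_notMem_range _ _ _ (by simp)
  simp only [LinearMap.comp_apply, LinearMap.mulRight_apply]
  rw [pullFun_σ_mul_xpow, integrateVar, DPPoly.lift_monomial, one_smul, pullFun_σ_monomial,
    Finsupp.add_apply, h0, Finsupp.single_eq_same, zero_add]
  congr 2
  rw [Finsupp.erase_add, Finsupp.erase_single, add_zero, Finsupp.erase_of_notMem_support]
  simp

end SplitFun

section SplitExt

variable {l m n : ℕ}

theorem pullDiff_dx (α : ⦋m⦌ ⟶ ⦋n⦌) (k : ℕ) :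
    pullDiff α (dx n k) = dx m (leastIndex α k) := by
  rcases Nat.eq_zero_or_pos k with rfl | hk
  · have h : ∀ n, dx n 0 = 0 := fun n => by ext j; simp [dx]
    rw [leastIndex_zero, h, h, map_zero]
  · by_cases hkn : k ≤ n
    · obtain ⟨k, rfl⟩ := Nat.exists_eq_succ_of_ne_zero hk.ne'
      have : dx n (k + 1) = Pi.basisFun ℤ (Fin n) ⟨k, hkn⟩ := by
        ext j
        simp [dx, Pi.single_apply, Fin.ext_iff]
      rw [Nat.succ_eq_add_one, this, pullDiff, Module.Basis.constr_basis]
      rfl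
    · have h : dx n k = 0 := by
        ext j; have := j.2; simp [dx]; omega
      rw [leastIndex_of_gt _ _ (by omega), h, map_zero]
      ext j; have := j.2; simp [dx]; omega

theorem diff_hom_ext {M : Type} [AddCommGroup M] {f g : Diff n →ₗ[ℤ] M}
    (h : ∀ k : Fin n, f (dx n (k + 1)) = g (dx n (k + 1))) : f = g := by
  refine (Pi.basisFun ℤ (Fin n)).ext fun k => ?_
  have : Pi.basisFun ℤ (Fin n) k = dx n (k + 1) := by
    ext j
    simp [dx, Pi.single_apply, Fin.ext_iff]
  rw [this, h]

theorem pullDiff_comp (α : ⦋l⦌ ⟶ ⦋m⦌) (β : ⦋m⦌ ⟶ ⦋n⦌) :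
    pullDiff (α ≫ β) = pullDiff α ∘ₗ pullDiff β := by
  refine diff_hom_ext fun k => ?_
  rw [LinearMap.comp_apply, pullDiff_dx, pullDiff_dx, pullDiff_dx, leastIndex_comp]

theorem pullDiff_id : pullDiff (𝟙 ⦋n⦌) = LinearMap.id := by
  refine diff_hom_ext fun k => ?_
  rw [LinearMap.id_apply, pullDiff_dx, leastIndex_id _ (by omega)]

/-- The coefficient of `dx_k`. -/
def coord (n k : ℕ) : Module.Dual ℤ (Diff n) :=
  ∑ j : Fin n, (dx n k j) • LinearMap.proj j

theorem coord_apply (k : ℕ) (v : Diff n) : coord n k v = ∑ j : Fin n, dx n k j * v j := by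
  simp [coord]

theorem coord_dx (k : ℕ) (hk : k < n) (a : ℕ) :
    coord n (k + 1) (dx n a) = if k + 1 = a then 1 else 0 := by
  rw [coord_apply, Finset.sum_eq_single ⟨k, hk⟩]
  · simp [dx]
  · intro b _ hb
    have : ¬ ((b : ℕ) = k) := fun h => hb (Fin.ext h)
    simp [dx, this]
  · simp

/-- Contraction of constant forms with the `k`-th coordinate vector field. -/
def contr (n k : ℕ) : ExteriorAlgebra ℤ (Diff n) →ₗ[ℤ] ExteriorAlgebra ℤ (Diff n) :=
  CliffordAlgebra.contractLeft (Q := (0 : QuadraticForm ℤ (Diff n))) (coord n k)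

theorem contr_ι_mul (k : ℕ) (v : Diff n) (w : ExteriorAlgebra ℤ (Diff n)) :
    contr n k (ExteriorAlgebra.ι ℤ v * w) =
      coord n k v • w - ExteriorAlgebra.ι ℤ v * contr n k w :=
  CliffordAlgebra.contractLeft_ι_mul _ _ _

theorem contr_algebraMap (k : ℕ) (a : ℤ) : contr n k (algebraMap ℤ _ a) = 0 :=
  CliffordAlgebra.contractLeft_algebraMap _ _ _

/-- Induction on elements of the exterior algebra, multiplying by vectors on the left. -/
theorem ext_induction {P : ExteriorAlgebra ℤ (Diff n) → Prop} (w : ExteriorAlgebra ℤ (Diff n))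
    (h0 : ∀ a : ℤ, P (algebraMap ℤ _ a)) (ha : ∀ v w, P v → P w → P (v + w))
    (hι : ∀ v w, P w → P (ExteriorAlgebra.ι ℤ v * w)) : P w :=
  CliffordAlgebra.left_induction (Q := (0 : QuadraticForm ℤ (Diff n))) h0
    (fun _ _ => ha _ _) (fun _ v => hι v _) w

theorem ι_mul_ι (v w : Diff n) :
    ExteriorAlgebra.ι ℤ v * ExteriorAlgebra.ι ℤ w =
      -(ExteriorAlgebra.ι ℤ w * ExteriorAlgebra.ι ℤ v) :=
  eq_neg_of_add_eq_zero_left (ExteriorAlgebra.ι_add_mul_swap v w)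

/-- `α^*` on constant forms. -/
def pullExt (α : ⦋m⦌ ⟶ ⦋n⦌) : ExteriorAlgebra ℤ (Diff n) →ₐ[ℤ] ExteriorAlgebra ℤ (Diff m) :=
  ExteriorAlgebra.map (pullDiff α)

theorem pullExt_comp (α : ⦋l⦌ ⟶ ⦋m⦌) (β : ⦋m⦌ ⟶ ⦋n⦌) (w : ExteriorAlgebra ℤ (Diff n)) :
    pullExt (α ≫ β) w = pullExt α (pullExt β w) := by
  have h := ExteriorAlgebra.map_comp_map (pullDiff β) (pullDiff α)
  rw [← pullDiff_comp] at h
  exact (DFunLike.congr_fun h w).symm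

theorem pullExt_id (w : ExteriorAlgebra ℤ (Diff n)) : pullExt (𝟙 ⦋n⦌) w = w := by
  rw [pullExt, pullDiff_id, ExteriorAlgebra.map_id]
  rfl

theorem coord_pullDiff_σ (i : Fin (n + 1)) (v : Diff n) :
    coord (n + 1) (i + 1) (pullDiff (SimplexCategory.σ i) v) = 0 := by
  change (coord (n + 1) (i + 1) ∘ₗ pullDiff (SimplexCategory.σ i)) v = (0 : Diff n →ₗ[ℤ] ℤ) v
  congr 1
  refine diff_hom_ext fun k => ?_
  rw [LinearMap.comp_apply, pullDiff_dx, coord_dx _ i.2, leastIndex_σ _ _ (by omega),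
    LinearMap.zero_apply]
  split_ifs <;> first | rfl | omega

theorem contr_pullExt_σ (i : Fin (n + 1)) (w : ExteriorAlgebra ℤ (Diff n)) :
    contr (n + 1) (i + 1) (pullExt (SimplexCategory.σ i) w) = 0 := by
  induction w using ext_induction with
  | h0 a => rw [AlgHom.commutes, contr_algebraMap]
  | ha v w hv hw => rw [map_add, map_add, hv, hw, add_zero]
  | hι v w hw =>
    rw [map_mul, show pullExt (SimplexCategory.σ i) (ExteriorAlgebra.ι ℤ v) = _ from
      ExteriorAlgebra.map_apply_ι _ _, contr_ι_mul, hw, coord_pullDiff_σ, zero_smul, mul_zero,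
      sub_zero]

theorem contr_dx_mul_pullExt_σ (i : Fin (n + 1)) (w : ExteriorAlgebra ℤ (Diff n)) :
    contr (n + 1) (i + 1) (ExteriorAlgebra.ι ℤ (dx (n + 1) (i + 1)) *
      pullExt (SimplexCategory.σ i) w) = pullExt (SimplexCategory.σ i) w := by
  rw [contr_ι_mul, contr_pullExt_σ, mul_zero, sub_zero, coord_dx _ i.2, if_pos rfl, one_smul]

theorem exists_diff_split (i : Fin (n + 1)) (v : Diff (n + 1)) :
    ∃ (a : ℤ) (u : Diff n), v = pullDiff (SimplexCategory.σ i) u + a • dx (n + 1) (i + 1) := by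
  have hv : v = ∑ k : Fin (n + 1), v k • dx (n + 1) (k + 1) := by
    ext j
    simp [dx, Fin.val_inj]
  refine ⟨v i, ∑ k : Fin n, v (i.succAbove k) • dx n (k + 1), ?_⟩
  refine hv.trans ?_
  rw [Fin.sum_univ_succAbove _ i, map_sum, add_comm (v i • _)]
  congr 1
  refine Finset.sum_congr rfl fun k _ => ?_
  rw [map_smul, pullDiff_dx, leastIndex_σ _ _ (by omega)]
  congr 2
  by_cases h : k.castSucc < i
  · rw [Fin.succAbove_of_castSucc_lt _ _ h, if_pos (by exact h)]
    rfl
  · rw [Fin.succAbove_of_le_castSucc _ _ (not_lt.1 h), if_neg (by exact h)]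
    rfl

/-- The constant forms `σ_i^* u` and `dx_{i+1} ∧ σ_i^* u` generate the exterior algebra. -/
theorem exists_ext_split (i : Fin (n + 1)) (w : ExteriorAlgebra ℤ (Diff (n + 1))) :
    ∃ u u' : ExteriorAlgebra ℤ (Diff n), w = pullExt (SimplexCategory.σ i) u +
      ExteriorAlgebra.ι ℤ (dx (n + 1) (i + 1)) * pullExt (SimplexCategory.σ i) u' := by
  induction w using ext_induction with
  | h0 a => exact ⟨algebraMap ℤ _ a, 0, by simp⟩
  | ha v w hv hw =>
    obtain ⟨u₁, u₁', rfl⟩ := hv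
    obtain ⟨u₂, u₂', rfl⟩ := hw
    exact ⟨u₁ + u₂, u₁' + u₂', by simp only [map_add, mul_add]; abel⟩
  | hι v w hw =>
    obtain ⟨u, u', rfl⟩ := hw
    obtain ⟨a, v, rfl⟩ := exists_diff_split i v
    have h : pullExt (SimplexCategory.σ i) (ExteriorAlgebra.ι ℤ v) =
      ExteriorAlgebra.ι ℤ (pullDiff (SimplexCategory.σ i) v) := ExteriorAlgebra.map_apply_ι _ _
    refine ⟨ExteriorAlgebra.ι ℤ v * u, a • u - ExteriorAlgebra.ι ℤ v * u', ?_⟩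
    rw [map_sub, map_mul, map_mul, h, map_add, map_smul, map_smul, add_mul, mul_add, mul_add,
      mul_sub, ← mul_assoc _ _ (pullExt _ u'), ι_mul_ι, smul_mul_assoc, smul_mul_assoc,
      ← mul_assoc _ _ (pullExt _ u'), ExteriorAlgebra.ι_sq_zero, mul_smul_comm, zero_mul, smul_zero,
      ← mul_assoc _ _ (pullExt _ u')]
    simp only [neg_mul]
    abel

end SplitExt

/-! ### The de Rham algebra of a simplex -/

section Omega

variable {l m n : ℕ}

/-- `α^*` as a homomorphism of algebras. -/
def pullAlg (α : ⦋m⦌ ⟶ ⦋n⦌) : Omega n →ₐ[ℤ] Omega m :=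
  Algebra.TensorProduct.map (pullExt α) (pullFunAlg α)

theorem pull_tmul (α : ⦋m⦌ ⟶ ⦋n⦌) (w : ExteriorAlgebra ℤ (Diff n)) (f : Fun n) :
    pull α (w ⊗ₜ f) = pullExt α w ⊗ₜ pullFun α f := rfl

theorem pull_mul (α : ⦋m⦌ ⟶ ⦋n⦌) (η θ : Omega n) : pull α (η * θ) = pull α η * pull α θ :=
  map_mul (pullAlg α) η θ

theorem pull_one (α : ⦋m⦌ ⟶ ⦋n⦌) : pull α 1 = 1 := map_one (pullAlg α)

theorem omega_hom_ext {M : Type} [AddCommGroup M] {f g : Omega n →ₗ[ℤ] M}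
    (h : ∀ w x, f (w ⊗ₜ x) = g (w ⊗ₜ x)) : f = g :=
  TensorProduct.ext' h

theorem pull_comp (α : ⦋l⦌ ⟶ ⦋m⦌) (β : ⦋m⦌ ⟶ ⦋n⦌) (η : Omega n) :
    pull (α ≫ β) η = pull α (pull β η) := by
  change _ = (pull α ∘ₗ pull β) η
  congr 1
  refine omega_hom_ext fun w f => ?_
  rw [LinearMap.comp_apply, pull_tmul, pull_tmul, pull_tmul, pullExt_comp, pullFun_comp]

theorem pull_id (η : Omega n) : pull (𝟙 ⦋n⦌) η = η := by
  change _ = (LinearMap.id : Omega n →ₗ[ℤ] Omega n) η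
  congr 1
  refine omega_hom_ext fun w f => ?_
  rw [pull_tmul, pullExt_id, pullFun_id, LinearMap.id_apply]

/-- The function `x_k^[s]`, as a form of degree `0`. -/
def ypow (n k s : ℕ) : Omega n := 1 ⊗ₜ xpow n k s

/-- The form `dx_k`. -/
def dX (n k : ℕ) : Omega n := ExteriorAlgebra.ι ℤ (dx n k) ⊗ₜ 1

theorem pull_ypow (α : ⦋m⦌ ⟶ ⦋n⦌) (k s : ℕ) :
    pull α (ypow n k s) = ypow m (leastIndex α k) s := by
  rw [ypow, pull_tmul, pullFun_xpow, map_one, ypow]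

theorem pull_dX (α : ⦋m⦌ ⟶ ⦋n⦌) (k : ℕ) : pull α (dX n k) = dX m (leastIndex α k) := by
  rw [dX, pull_tmul, pullFun_one, show pullExt α (ExteriorAlgebra.ι ℤ (dx n k)) = _ from
    ExteriorAlgebra.map_apply_ι _ _, pullDiff_dx, dX]

theorem ypow_zero (k : ℕ) : ypow n k 0 = 1 := by rw [ypow, xpow_zero]; rfl

theorem ypow_mul_comm (k s : ℕ) (η : Omega n) : ypow n k s * η = η * ypow n k s := by
  rw [ypow]
  induction η using TensorProduct.induction_on with
  | zero => simp
  | add η θ hη hθ => simp only [mul_add, add_mul, hη, hθ]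
  | tmul w g =>
    rw [Algebra.TensorProduct.tmul_mul_tmul, Algebra.TensorProduct.tmul_mul_tmul, one_mul, mul_one,
      mul_comm]

/-- The forms `σ_i^* η · x_{i+1}^[s]` and `dx_{i+1} ∧ σ_i^* η · x_{i+1}^[s]`, for forms `η` on
the standard `n`-simplex, generate the forms on the standard `(n + 1)`-simplex. -/
theorem omega_induction (i : Fin (n + 1)) {P : Omega (n + 1) → Prop} (ω : Omega (n + 1))
    (h0 : ∀ η s, P (pull (SimplexCategory.σ i) η * ypow (n + 1) (i + 1) s))
    (h1 : ∀ η s, P (dX (n + 1) (i + 1) * pull (SimplexCategory.σ i) η *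
      ypow (n + 1) (i + 1) s))
    (ha : ∀ η θ, P η → P θ → P (η + θ)) : P ω := by
  induction ω using TensorProduct.induction_on with
  | zero => simpa using h0 0 0
  | add η θ hη hθ => exact ha η θ hη hθ
  | tmul w f =>
    induction f using fun_induction i with
    | ha f g hf hg => rw [TensorProduct.tmul_add]; exact ha _ _ hf hg
    | hm h s =>
      obtain ⟨u, u', rfl⟩ := exists_ext_split i w
      rw [TensorProduct.add_tmul]
      refine ha _ _ ?_ ?_
      · have := h0 (u ⊗ₜ h) s
        rwa [pull_tmul, ypow, Algebra.TensorProduct.tmul_mul_tmul, mul_one] at this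
      · have := h1 (u' ⊗ₜ h) s
        rwa [pull_tmul, ypow, dX, Algebra.TensorProduct.tmul_mul_tmul, one_mul,
          Algebra.TensorProduct.tmul_mul_tmul, mul_one] at this

theorem omega_hom_ext_split (i : Fin (n + 1)) {M : Type} [AddCommGroup M]
    {f g : Omega (n + 1) →ₗ[ℤ] M}
    (h0 : ∀ η s, f (pull (SimplexCategory.σ i) η * ypow (n + 1) (i + 1) s) =
      g (pull (SimplexCategory.σ i) η * ypow (n + 1) (i + 1) s))
    (h1 : ∀ η s, f (dX (n + 1) (i + 1) * pull (SimplexCategory.σ i) η * ypow (n + 1) (i + 1) s) =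
      g (dX (n + 1) (i + 1) * pull (SimplexCategory.σ i) η * ypow (n + 1) (i + 1) s)) :
    f = g := by
  refine LinearMap.ext fun ω => ?_
  induction ω using omega_induction i with
  | h0 η s => exact h0 η s
  | h1 η s => exact h1 η s
  | ha η θ hη hθ => rw [map_add, map_add, hη, hθ]

/-! ### The differential -/

theorem dOmega_tmul (w : ExteriorAlgebra ℤ (Diff n)) (f : Fun n) :
    dOmega n (w ⊗ₜ f) =
      ∑ i : Fin n, (ExteriorAlgebra.ι ℤ (dx n (i + 1)) * w) ⊗ₜ partialDeriv i.succ f := by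
  unfold dOmega
  exact LinearMap.sum_apply _ _ _

/-- For a function `f`, no sign appears in `d (η f) = dη f + df ∧ η`. -/
theorem dOmega_mul_fun (η : Omega n) (f : Fun n) :
    dOmega n (η * (1 ⊗ₜ f)) = dOmega n η * (1 ⊗ₜ f) + dOmega n (1 ⊗ₜ f) * η := by
  induction η using TensorProduct.induction_on with
  | zero => simp
  | add η θ hη hθ => simp only [add_mul, mul_add, map_add, hη, hθ]; abel
  | tmul w g =>
    rw [Algebra.TensorProduct.tmul_mul_tmul, mul_one, dOmega_tmul, dOmega_tmul, dOmega_tmul,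
      Finset.sum_mul, Finset.sum_mul, ← Finset.sum_add_distrib]
    refine Finset.sum_congr rfl fun i _ => ?_
    rw [Algebra.TensorProduct.tmul_mul_tmul, Algebra.TensorProduct.tmul_mul_tmul, mul_one, mul_one,
      partialDeriv_mul, TensorProduct.tmul_add, mul_comm g]

theorem dX_mul_self (k : ℕ) : dX n k * dX n k = 0 := by
  rw [dX, Algebra.TensorProduct.tmul_mul_tmul, ExteriorAlgebra.ι_sq_zero, TensorProduct.zero_tmul]

theorem dOmega_dX_mul (k : ℕ) (η : Omega n) : dOmega n (dX n k * η) = -(dX n k * dOmega n η) := by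
  induction η using TensorProduct.induction_on with
  | zero => simp
  | add η θ hη hθ => simp only [mul_add, map_add, hη, hθ]; abel
  | tmul w g =>
    rw [dX, Algebra.TensorProduct.tmul_mul_tmul, one_mul, dOmega_tmul, dOmega_tmul,
      Finset.mul_sum, ← Finset.sum_neg_distrib]
    refine Finset.sum_congr rfl fun i _ => ?_
    rw [Algebra.TensorProduct.tmul_mul_tmul, one_mul, ← mul_assoc, ← mul_assoc, ι_mul_ι, neg_mul,
      TensorProduct.neg_tmul]

theorem dX_zero : dX n 0 = 0 := by
  have : dx n 0 = 0 := by ext j; simp [dx]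
  rw [dX, this, map_zero, TensorProduct.zero_tmul]

theorem dX_of_gt (k : ℕ) (hk : n < k) : dX n k = 0 := by
  have : dx n k = 0 := by ext j; have := j.2; simp [dx]; omega
  rw [dX, this, map_zero, TensorProduct.zero_tmul]

theorem dOmega_ypow_succ (k s : ℕ) : dOmega n (ypow n k (s + 1)) = dX n k * ypow n k s := by
  rw [ypow, dOmega_tmul]
  simp_rw [partialDeriv_xpow_succ, Fin.val_succ, mul_one]
  by_cases h : 0 < k ∧ k ≤ n
  · obtain ⟨k, rfl⟩ := Nat.exists_eq_succ_of_ne_zero h.1.ne'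
    rw [Finset.sum_eq_single ⟨k, h.2⟩]
    · rw [if_pos rfl, dX, ypow, Algebra.TensorProduct.tmul_mul_tmul, one_mul, mul_one]
    · intro b _ hb
      rw [if_neg (fun h => hb (Fin.ext (Nat.succ_injective h))), TensorProduct.tmul_zero]
    · simp
  · have : dX n k = 0 := by
      rcases Nat.eq_zero_or_pos k with rfl | hk
      · exact dX_zero
      · exact dX_of_gt _ (by omega)
    rw [this, zero_mul]
    refine Finset.sum_eq_zero fun i _ => ?_
    have := i.2
    rw [if_neg (by omega), TensorProduct.tmul_zero]

theorem dOmega_one : dOmega n 1 = 0 := by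
  change dOmega n (1 ⊗ₜ 1) = 0
  rw [dOmega_tmul]
  simp [partialDeriv_one]

theorem dOmega_mul_ypow_succ (η : Omega n) (k s : ℕ) :
    dOmega n (η * ypow n k (s + 1)) =
      dOmega n η * ypow n k (s + 1) + dX n k * η * ypow n k s := by
  rw [ypow, dOmega_mul_fun, ← ypow, dOmega_ypow_succ, mul_assoc, mul_assoc]
  rw [ypow_mul_comm]

theorem dOmega_pull_σ (i : Fin (n + 1)) (η : Omega n) :
    dOmega (n + 1) (pull (SimplexCategory.σ i) η) = pull (SimplexCategory.σ i) (dOmega n η) := by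
  change (dOmega (n + 1) ∘ₗ pull (SimplexCategory.σ i)) η =
    (pull (SimplexCategory.σ i) ∘ₗ dOmega n) η
  congr 1
  refine omega_hom_ext fun w f => ?_
  rw [LinearMap.comp_apply, LinearMap.comp_apply, pull_tmul, dOmega_tmul, dOmega_tmul, map_sum,
    Fin.sum_univ_succAbove _ i, partialDeriv_pullFun_σ_self, TensorProduct.tmul_zero, zero_add]
  refine Finset.sum_congr rfl fun k _ => ?_
  have h : (i.succAbove k).succ = i.succ.succAbove k.succ := by simp
  have h' : ((i.succAbove k : Fin (n + 1)) : ℕ) + 1 = (i.succ.succAbove k.succ : Fin (n + 2)) := by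
    rw [← h, Fin.val_succ]
  rw [pull_tmul, h, partialDeriv_pullFun_σ, map_mul, h', val_succ_succAbove,
    show pullExt (SimplexCategory.σ i) (ExteriorAlgebra.ι ℤ (dx n (k + 1))) = _ from
    ExteriorAlgebra.map_apply_ι _ _, pullDiff_dx, leastIndex_σ _ _ (by omega), Fin.val_succ]

/-! ### Integration over one variable -/

/-- Integration of forms along `x_k`, from `x_a` to `x_b`, without changing the simplex. -/
def integrateStep {n : ℕ} (k : Fin (n + 1)) (a b : ℕ) : Omega n →ₗ[ℤ] Omega n :=
  TensorProduct.map (contr n k) (integrateVar k a b)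

theorem integrateStep_tmul (k : Fin (n + 1)) (a b : ℕ) (w : ExteriorAlgebra ℤ (Diff n))
    (f : Fun n) : integrateStep k a b (w ⊗ₜ f) = contr n k w ⊗ₜ integrateVar k a b f := rfl

theorem integrateStep_pull_σ (i : Fin (n + 1)) (a b : ℕ) (η : Omega n) (s : ℕ) :
    integrateStep i.succ a b (pull (SimplexCategory.σ i) η * ypow (n + 1) (i + 1) s) = 0 := by
  induction η using TensorProduct.induction_on with
  | zero => simp
  | add η θ hη hθ => simp only [map_add, add_mul, hη, hθ, add_zero]
  | tmul w f =>
    rw [pull_tmul, ypow, Algebra.TensorProduct.tmul_mul_tmul, mul_one,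
      integrateStep_tmul, Fin.val_succ, contr_pullExt_σ, TensorProduct.zero_tmul]

theorem integrateStep_dX_mul (i : Fin (n + 1)) (a b : ℕ) (η : Omega n) (s : ℕ) :
    integrateStep i.succ a b (dX (n + 1) (i + 1) * pull (SimplexCategory.σ i) η *
      ypow (n + 1) (i + 1) s) =
    pull (SimplexCategory.σ i) η * (ypow (n + 1) b (s + 1) - ypow (n + 1) a (s + 1)) := by
  induction η using TensorProduct.induction_on with
  | zero => simp
  | add η θ hη hθ => simp only [map_add, mul_add, add_mul, hη, hθ]
  | tmul w f =>
    rw [pull_tmul, ypow, dX, Algebra.TensorProduct.tmul_mul_tmul, one_mul,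
      Algebra.TensorProduct.tmul_mul_tmul, mul_one,
      integrateStep_tmul, Fin.val_succ, contr_dx_mul_pullExt_σ, integrateVar_mul_xpow, ypow,
      ypow, ← TensorProduct.tmul_sub, Algebra.TensorProduct.tmul_mul_tmul, mul_one]

/-- Integration of a form on the standard `(n + 1)`-simplex over the fibers of `σ_i`, i.e. along
`x_{i+1}` from `x_{i+2}` to `x_i`. -/
def fiberStep (i : Fin (n + 1)) : Omega (n + 1) →ₗ[ℤ] Omega n :=
  pull (SimplexCategory.δ i.succ) ∘ₗ integrateStep i.succ (i + 2) i

theorem fiberStep_pull_σ (i : Fin (n + 1)) (η : Omega n) (s : ℕ) :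
    fiberStep i (pull (SimplexCategory.σ i) η * ypow (n + 1) (i + 1) s) = 0 := by
  rw [fiberStep, LinearMap.comp_apply, integrateStep_pull_σ, map_zero]

theorem pull_δ_succ_pull_σ (i : Fin (n + 1)) (η : Omega n) :
    pull (SimplexCategory.δ i.succ) (pull (SimplexCategory.σ i) η) = η := by
  rw [← pull_comp, SimplexCategory.δ_comp_σ_succ, pull_id]

theorem pull_δ_castSucc_pull_σ (i : Fin (n + 1)) (η : Omega n) :
    pull (SimplexCategory.δ i.castSucc) (pull (SimplexCategory.σ i) η) = η := by
  rw [← pull_comp, SimplexCategory.δ_comp_σ_self, pull_id]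

theorem fiberStep_dX_mul (i : Fin (n + 1)) (η : Omega n) (s : ℕ) :
    fiberStep i (dX (n + 1) (i + 1) * pull (SimplexCategory.σ i) η * ypow (n + 1) (i + 1) s) =
      η * (ypow n i (s + 1) - ypow n (i + 1) (s + 1)) := by
  rw [fiberStep, LinearMap.comp_apply, integrateStep_dX_mul, pull_mul, pull_δ_succ_pull_σ, map_sub,
    pull_ypow, pull_ypow, leastIndex_δ _ _ (by omega), leastIndex_δ _ _ (by omega),
    if_pos (by simp), if_neg (by simp)]
  rfl

/-- Integration over the fibers of `σ_i` is a chain homotopy between the restrictions to the two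
faces that are sections of `σ_i`. -/
theorem dOmega_fiberStep (i : Fin (n + 1)) (ω : Omega (n + 1)) :
    dOmega n (fiberStep i ω) + fiberStep i (dOmega (n + 1) ω) =
      pull (SimplexCategory.δ i.castSucc) ω - pull (SimplexCategory.δ i.succ) ω := by
  change (dOmega n ∘ₗ fiberStep i + fiberStep i ∘ₗ dOmega (n + 1)) ω =
    (pull (SimplexCategory.δ i.castSucc) - pull (SimplexCategory.δ i.succ)) ω
  congr 1
  have e1 : leastIndex (SimplexCategory.δ i.castSucc) ((i : ℕ) + 1) = i := by
    rw [leastIndex_δ _ _ (by omega), if_neg (by simp)]; rfl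
  have e2 : leastIndex (SimplexCategory.δ i.succ) ((i : ℕ) + 1) = i + 1 := by
    rw [leastIndex_δ _ _ (by omega), if_pos (by simp)]
  refine omega_hom_ext_split i (fun η s => ?_) fun η s => ?_
  · simp only [LinearMap.add_apply, LinearMap.sub_apply, LinearMap.comp_apply]
    rw [fiberStep_pull_σ, map_zero, zero_add, pull_mul, pull_mul, pull_δ_succ_pull_σ,
      pull_δ_castSucc_pull_σ, pull_ypow, pull_ypow, e1, e2]
    rcases s with _ | s
    · rw [ypow_zero, ypow_zero, ypow_zero, mul_one, dOmega_pull_σ, mul_one, sub_self]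
      simpa [ypow_zero] using fiberStep_pull_σ i (dOmega n η) 0
    · rw [dOmega_mul_ypow_succ, map_add, dOmega_pull_σ, fiberStep_pull_σ, zero_add,
        fiberStep_dX_mul, mul_sub]
  · simp only [LinearMap.add_apply, LinearMap.sub_apply, LinearMap.comp_apply]
    rw [fiberStep_dX_mul, pull_mul, pull_mul, pull_mul, pull_mul, pull_δ_succ_pull_σ,
      pull_δ_castSucc_pull_σ, pull_ypow, pull_ypow, pull_dX, pull_dX, e1, e2, mul_sub, map_sub,
      dOmega_mul_ypow_succ, dOmega_mul_ypow_succ, mul_assoc (dX (n + 1) _), dOmega_dX_mul, map_neg]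
    have h : dX (n + 1) (i + 1) * dOmega (n + 1) (pull (SimplexCategory.σ i) η *
        ypow (n + 1) (i + 1) s) =
        dX (n + 1) (i + 1) * pull (SimplexCategory.σ i) (dOmega n η) *
          ypow (n + 1) (i + 1) s := by
      rcases s with _ | s
      · rw [ypow_zero, mul_one, mul_one, dOmega_pull_σ]
      · rw [dOmega_mul_ypow_succ, mul_add, dOmega_pull_σ, ← mul_assoc, mul_assoc (dX (n + 1) _)
          (pull _ η), ← mul_assoc (dX (n + 1) _), dX_mul_self, zero_mul, add_zero]
    rw [h, fiberStep_dX_mul, mul_sub]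
    abel

theorem fiberStep_mul_pull (i : Fin (n + 1)) (ω : Omega (n + 1)) (θ : Omega n) :
    fiberStep i (ω * pull (SimplexCategory.σ i) θ) = fiberStep i ω * θ := by
  induction ω using omega_induction i with
  | ha η θ hη hθ => simp only [map_add, add_mul, hη, hθ]
  | h0 η s =>
    rw [mul_assoc, ypow_mul_comm, ← mul_assoc, ← pull_mul, fiberStep_pull_σ,
      fiberStep_pull_σ, zero_mul]
  | h1 η s =>
    rw [mul_assoc, ypow_mul_comm, ← mul_assoc, mul_assoc (dX _ _), ← pull_mul, fiberStep_dX_mul,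
      fiberStep_dX_mul, mul_assoc, mul_assoc, sub_mul, ypow_mul_comm, ypow_mul_comm, mul_sub]

end Omega

/-! ### Signs -/

section Graded

variable {n : ℕ}

theorem mul_ι_of_mem {p : ℕ} {w : ExteriorAlgebra ℤ (Diff n)} (hw : w ∈ ⋀[ℤ]^p (Diff n))
    (v : Diff n) : w * ExteriorAlgebra.ι ℤ v = (-1 : ℤ) ^ p • (ExteriorAlgebra.ι ℤ v * w) := by
  induction hw using Submodule.pow_induction_on_left' with
  | algebraMap a => rw [pow_zero, one_smul, Algebra.commutes]
  | add x y i hx hy h1 h2 => rw [add_mul, mul_add, smul_add, h1, h2]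
  | mem_mul m hm i x hx h =>
    obtain ⟨u, rfl⟩ := hm
    rw [mul_assoc, h, mul_smul_comm, ← mul_assoc, ← mul_assoc, ι_mul_ι u v, neg_mul, pow_succ,
      smul_neg, mul_neg_one, neg_smul]

theorem omegaDeg_induction {p : ℕ} {P : Omega n → Prop} {θ : Omega n} (hθ : θ ∈ OmegaDeg n p)
    (h : ∀ w ∈ ⋀[ℤ]^p (Diff n), ∀ f, P (w ⊗ₜ f)) (ha : ∀ η θ, P η → P θ → P (η + θ)) : P θ := by
  obtain ⟨t, rfl⟩ := hθ
  induction t using TensorProduct.induction_on with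
  | zero =>
    have e := LinearMap.map_zero
      (TensorProduct.map (⋀[ℤ]^p (Diff n)).subtype (LinearMap.id : Fun n →ₗ[ℤ] Fun n))
    refine (congrArg P e).mpr ?_
    rw [← TensorProduct.zero_tmul (ExteriorAlgebra ℤ (Diff n)) (0 : Fun n)]
    exact h 0 (Submodule.zero_mem _) 0
  | add x y hx hy =>
    have e := LinearMap.map_add
      (TensorProduct.map (⋀[ℤ]^p (Diff n)).subtype (LinearMap.id : Fun n →ₗ[ℤ] Fun n)) x y
    exact (congrArg P e).mpr (ha _ _ hx hy)
  | tmul w f => exact h w.1 w.2 f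

theorem mul_dX_of_mem {p : ℕ} {θ : Omega n} (hθ : θ ∈ OmegaDeg n p) (k : ℕ) :
    θ * dX n k = (-1 : ℤ) ^ p • (dX n k * θ) := by
  refine omegaDeg_induction (P := fun θ => θ * dX n k = (-1 : ℤ) ^ p • (dX n k * θ)) hθ
    (fun w hw f => ?_) fun η θ h1 h2 => ?_
  · rw [dX, Algebra.TensorProduct.tmul_mul_tmul, Algebra.TensorProduct.tmul_mul_tmul,
      mul_ι_of_mem hw, mul_one, one_mul]
    rfl
  · rw [add_mul, mul_add, h1, h2, smul_add]

theorem dOmega_mul {p : ℕ} {θ : Omega n} (hθ : θ ∈ OmegaDeg n p) (ω : Omega n) :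
    dOmega n (θ * ω) = dOmega n θ * ω + (-1 : ℤ) ^ p • (θ * dOmega n ω) := by
  refine omegaDeg_induction (P := fun θ => dOmega n (θ * ω) =
    dOmega n θ * ω + (-1 : ℤ) ^ p • (θ * dOmega n ω)) hθ
    (fun w hw f => ?_) fun η θ h1 h2 => ?_
  · induction ω using TensorProduct.induction_on with
    | zero => simp
    | add η θ hη hθ => simp only [mul_add, map_add, hη, hθ, smul_add]; abel
    | tmul w' g =>
      rw [Algebra.TensorProduct.tmul_mul_tmul, dOmega_tmul, dOmega_tmul, dOmega_tmul,
        Finset.sum_mul, Finset.mul_sum, Finset.smul_sum, ← Finset.sum_add_distrib]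
      refine Finset.sum_congr rfl fun i _ => ?_
      rw [Algebra.TensorProduct.tmul_mul_tmul, Algebra.TensorProduct.tmul_mul_tmul,
        partialDeriv_mul, TensorProduct.tmul_add, ← mul_assoc, ← mul_assoc,
        mul_ι_of_mem hw, smul_mul_assoc]
      congr 1
      refine Eq.trans ?_ (congrArg _ (TensorProduct.smul_tmul' ((-1 : ℤ) ^ p) _ _))
      have h : ((-1 : ℤ) ^ p) * ((-1 : ℤ) ^ p) = 1 := by
        rw [← mul_pow]; simp
      rw [smul_smul, h, one_smul]
  · simp only [add_mul, map_add, h1, h2, smul_add]; abel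

theorem fiberStep_pull_mul {p : ℕ} (i : Fin (n + 1)) {θ : Omega n}
    (hθ : pull (SimplexCategory.σ i) θ ∈ OmegaDeg (n + 1) p) (ω : Omega (n + 1)) :
    fiberStep i (pull (SimplexCategory.σ i) θ * ω) = (-1 : ℤ) ^ p • (θ * fiberStep i ω) := by
  induction ω using omega_induction i with
  | ha η ξ hη hξ => simp only [map_add, mul_add, hη, hξ, smul_add]
  | h0 η s =>
    rw [← mul_assoc, ← pull_mul, fiberStep_pull_σ, fiberStep_pull_σ, mul_zero, smul_zero]
  | h1 η s =>
    rw [← mul_assoc, ← mul_assoc, mul_dX_of_mem hθ, smul_mul_assoc, smul_mul_assoc, map_smul,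
      mul_assoc (dX _ _), ← pull_mul, fiberStep_dX_mul, fiberStep_dX_mul, mul_assoc]

end Graded

/-! ### Naturality of the integration over one variable -/

section Naturality

variable {m n r : ℕ}

/-- The map `[m + 1] → [n + 1]` induced by `β : [m] → [n]` on the ordered sets in which the vertex
`i` of `[m]` and the vertex `β i` of `[n]` are doubled. -/
def doubleVertex (β : ⦋m⦌ ⟶ ⦋n⦌) (i : Fin (m + 1)) : ⦋m + 1⦌ ⟶ ⦋n + 1⦌ :=
  SimplexCategory.Hom.mk ⟨fun j : Fin (m + 2) =>
    if j ≤ i.castSucc then (β.toOrderHom ((SimplexCategory.σ i).toOrderHom j)).castSucc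
    else (β.toOrderHom ((SimplexCategory.σ i).toOrderHom j)).succ, by
    intro a b h
    have h1 : ((β.toOrderHom ((SimplexCategory.σ i).toOrderHom a) : Fin (n + 1)) : ℕ) ≤
      (β.toOrderHom ((SimplexCategory.σ i).toOrderHom b) : Fin (n + 1)) :=
      β.toOrderHom.monotone ((SimplexCategory.σ i).toOrderHom.monotone h)
    change (_ : Fin (n + 2)) ≤ _
    dsimp only
    rw [Fin.le_def]
    split_ifs with ha hb hb
    · simpa using h1
    · simp; omega
    · exact absurd (h.trans hb) ha
    · simpa using h1⟩

theorem doubleVertex_apply (β : ⦋m⦌ ⟶ ⦋n⦌) (i : Fin (m + 1)) (j : Fin (m + 2)) :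
    (((doubleVertex β i).toOrderHom j : Fin (n + 2)) : ℕ) =
      if (j : ℕ) ≤ i then ((β.toOrderHom ((SimplexCategory.σ i).toOrderHom j) : Fin (n + 1)) : ℕ)
      else ((β.toOrderHom ((SimplexCategory.σ i).toOrderHom j) : Fin (n + 1)) : ℕ) + 1 := by
  change (((if j ≤ i.castSucc then _ else _ : Fin (n + 2))) : ℕ) = _
  have : j ≤ i.castSucc ↔ (j : ℕ) ≤ i := Iff.rfl
  simp only [this]
  split_ifs <;> rfl

theorem hom_ext' {α β : ⦋m⦌ ⟶ ⦋n⦌}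
    (h : ∀ j : Fin (m + 1), ((α.toOrderHom j : Fin (n + 1)) : ℕ) = (β.toOrderHom j : Fin (n + 1))) :
    α = β := by
  ext j
  exact h j

theorem toOrderHom_le (β : ⦋m⦌ ⟶ ⦋n⦌) {a b : Fin (m + 1)} (h : (a : ℕ) ≤ b) :
    ((β.toOrderHom a : Fin (n + 1)) : ℕ) ≤ (β.toOrderHom b : Fin (n + 1)) :=
  β.toOrderHom.monotone h

theorem comp_apply' {l : ℕ} (α : ⦋l⦌ ⟶ ⦋m⦌) (β : ⦋m⦌ ⟶ ⦋n⦌) (j : Fin (l + 1)) :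
    (α ≫ β).toOrderHom j = β.toOrderHom (α.toOrderHom j) := rfl

theorem doubleVertex_comp_σ (β : ⦋m⦌ ⟶ ⦋n⦌) (i : Fin (m + 1)) :
    doubleVertex β i ≫ SimplexCategory.σ (β.toOrderHom i) = SimplexCategory.σ i ≫ β := by
  refine hom_ext' fun j => ?_
  rw [comp_apply', comp_apply', σ_apply (n := n), doubleVertex_apply]
  have hσ := σ_apply i j
  split_ifs at hσ ⊢ with h1 h2 h2
  · rfl
  · exact absurd (toOrderHom_le β (by rw [hσ]; exact h1)) h2
  · have := toOrderHom_le β (a := i) (b := (SimplexCategory.σ i).toOrderHom j)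
      (by rw [hσ]; omega)
    omega
  · rfl

theorem leastIndex_doubleVertex (β : ⦋m⦌ ⟶ ⦋n⦌) (i : Fin (m + 1)) :
    leastIndex (doubleVertex β i) (((β.toOrderHom i : Fin (n + 1)) : ℕ) + 1) = i + 1 := by
  refine leastIndex_eq _ _ _ (by omega) fun j => ?_
  rw [doubleVertex_apply]
  have hσ := σ_apply i j
  split_ifs at hσ ⊢ with h1
  · have := toOrderHom_le β (a := (SimplexCategory.σ i).toOrderHom j) (b := i)
      (by rw [hσ]; exact h1)
    omega
  · have := toOrderHom_le β (a := i) (b := (SimplexCategory.σ i).toOrderHom j)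
      (by rw [hσ]; omega)
    omega

/-- The vertices `i'` with `β i' = i` form the half-open interval from `leastIndex β i` to
`leastIndex β (i + 1)`. -/
theorem sum_telescope {A : Type} [AddCommGroup A] (β : ⦋m⦌ ⟶ ⦋n⦌) (i : Fin (n + 1)) (g : ℕ → A) :
    (∑ i' : Fin (m + 1), if β.toOrderHom i' = i then g i' - g (i' + 1) else 0) =
      g (leastIndex β i) - g (leastIndex β (i + 1)) := by
  have h1 : ∀ a b, a ≤ b → ∑ k ∈ Finset.Ico a b, (g k - g (k + 1)) = g a - g b := by
    intro a b hab
    induction b, hab using Nat.le_induction with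
    | base => simp
    | succ b hab ih => rw [Finset.sum_Ico_succ_top hab, ih]; abel
  rw [← h1 _ _ (leastIndex_mono β (Nat.le_succ _)), ← Finset.sum_filter]
  refine Finset.sum_bij (fun j _ => (j : ℕ)) ?_ (fun _ _ _ _ h => Fin.ext h) ?_ fun _ _ => rfl
  · intro j hj
    have hj : β.toOrderHom j = i := by simpa using hj
    rw [Finset.mem_Ico, ← not_le, leastIndex_le_iff, leastIndex_le_iff, hj]
    omega
  · intro b hb
    rw [Finset.mem_Ico] at hb
    have hb' : b < m + 1 := hb.2.trans_le (leastIndex_le _ _)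
    refine ⟨⟨b, hb'⟩, ?_, rfl⟩
    have h2 := (leastIndex_le_iff β i ⟨b, hb'⟩).1 hb.1
    have h3 := mt (leastIndex_le_iff β (i + 1) ⟨b, hb'⟩).2 (not_le.2 hb.2)
    rw [Finset.mem_filter]
    exact ⟨Finset.mem_univ _, Fin.ext (by omega)⟩

/-- Naturality of the integration over the fibers of `σ_i`: under `β^*`, the interval from
`x_{i+1}` to `x_i` is subdivided at the variables that `β^*` inserts. -/
theorem pull_fiberStep (β : ⦋m⦌ ⟶ ⦋n⦌) (i : Fin (n + 1)) (ω : Omega (n + 1)) :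
    pull β (fiberStep i ω) = ∑ i' : Fin (m + 1),
      if β.toOrderHom i' = i then fiberStep i' (pull (doubleVertex β i') ω) else 0 := by
  induction ω using omega_induction i with
  | ha η θ hη hθ =>
    rw [map_add, map_add, hη, hθ, ← Finset.sum_add_distrib]
    refine Finset.sum_congr rfl fun i' _ => ?_
    split_ifs
    · rw [map_add, map_add]
    · rw [add_zero]
  | h0 η s =>
    rw [fiberStep_pull_σ, map_zero]
    refine (Finset.sum_eq_zero fun i' _ => ?_).symm
    split_ifs with h
    · subst h
      rw [pull_mul, ← pull_comp, doubleVertex_comp_σ, pull_comp, pull_ypow,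
        leastIndex_doubleVertex, fiberStep_pull_σ]
    · rfl
  | h1 η s =>
    rw [fiberStep_dX_mul, pull_mul, map_sub, pull_ypow, pull_ypow,
      ← sum_telescope β i fun k => ypow m k (s + 1), Finset.mul_sum]
    refine Finset.sum_congr rfl fun i' _ => ?_
    split_ifs with h
    · subst h
      rw [pull_mul, pull_mul, ← pull_comp, doubleVertex_comp_σ, pull_comp, pull_ypow, pull_dX,
        leastIndex_doubleVertex, fiberStep_dX_mul]
    · rw [mul_zero]

end Naturality

/-! ### Forms on `X × Δ^r` -/

section ProductForms

variable {X Y : SSet.{u}} {m n r : ℕ}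

/-- The simplex of `X × Δ^r` with the components `x` and `α`. -/
def pairSimplex (x : X _⦋n⦌) (α : ⦋n⦌ ⟶ ⦋r⦌) : (X ⊗ (Δ[r] : SSet.{u}) : SSet.{u}) _⦋n⦌ :=
  ((x, SSet.stdSimplex.objEquiv.symm α) : X _⦋n⦌ × (Δ[r] : SSet.{u}) _⦋n⦌)

theorem exists_pairSimplex (z : (X ⊗ (Δ[r] : SSet.{u}) : SSet.{u}) _⦋n⦌) :
    ∃ x α, z = pairSimplex x α :=
  ⟨z.1, SSet.stdSimplex.objEquiv z.2, rfl⟩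

theorem map_pairSimplex (β : ⦋m⦌ ⟶ ⦋n⦌) (x : X _⦋n⦌) (α : ⦋n⦌ ⟶ ⦋r⦌) :
    (X ⊗ (Δ[r] : SSet.{u}) : SSet.{u}).map β.op (pairSimplex x α) =
      pairSimplex (X.map β.op x) (β ≫ α) := rfl

theorem family_ext {ω η : Family (X ⊗ (Δ[r] : SSet.{u}))}
    (h : ∀ n (x : X _⦋n⦌) α, ω n (pairSimplex x α) = η n (pairSimplex x α)) : ω = η := by
  funext n z
  obtain ⟨x, α, rfl⟩ := exists_pairSimplex z
  exact h n x α

theorem map_comp_apply' {l : ℕ} (α : ⦋l⦌ ⟶ ⦋m⦌) (β : ⦋m⦌ ⟶ ⦋n⦌) (x : X _⦋n⦌) :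
    X.map α.op (X.map β.op x) = X.map (α ≫ β).op x := by
  rw [op_comp, X.map_comp]
  rfl

theorem map_id_apply' (x : X _⦋n⦌) : X.map (𝟙 ⦋n⦌ : ⦋n⦌ ⟶ ⦋n⦌).op x = x := by
  rw [op_id, X.map_id]
  rfl

theorem IsForm.pullback {ω : Family Y} (hω : IsForm ω) (f : X ⟶ Y) : IsForm (pullback f ω) := by
  intro m n α x
  have h : f.app (op ⦋m⦌) (X.map α.op x) = Y.map α.op (f.app (op ⦋n⦌) x) :=
    congrArg (fun g => g x) (f.naturality α.op)
  change ω m _ = pull α (ω n _)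
  rw [← hω, ← h]

theorem IsForm.mul {ω η : Family X} (hω : IsForm ω) (hη : IsForm η) : IsForm (ω * η) := by
  intro m n α x
  change ω m _ * η m _ = pull α (ω n x * η n x)
  rw [hω, hη, pull_mul]

theorem isForm_one : IsForm (1 : Family X) := fun _ _ α _ => (pull_one α).symm

theorem IsHomogeneous.pullback {p : ℕ} {ω : Family Y} (hω : IsHomogeneous p ω) (f : X ⟶ Y) :
    IsHomogeneous p (pullback f ω) := fun n x => hω n (f.app _ x)

/-- The map that sends `j` to `0` for `j < k` and to `α j + 1` otherwise. -/
def shiftFrom (α : ⦋n⦌ ⟶ ⦋r⦌) (k : ℕ) : ⦋n⦌ ⟶ ⦋r + 1⦌ :=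
  SimplexCategory.Hom.mk ⟨fun j : Fin (n + 1) =>
    if (j : ℕ) < k then (0 : Fin (r + 2)) else (α.toOrderHom j).succ, by
    intro a b h
    have h1 := toOrderHom_le α (a := a) (b := b) h
    have h2 : (a : ℕ) ≤ b := h
    change (_ : Fin (r + 2)) ≤ _
    dsimp only
    rw [Fin.le_def]
    split_ifs with ha hb hb
    · rfl
    · simp
    · omega
    · simpa using h1⟩

theorem shiftFrom_apply (α : ⦋n⦌ ⟶ ⦋r⦌) (k : ℕ) (j : Fin (n + 1)) :
    (((shiftFrom α k).toOrderHom j : Fin (r + 2)) : ℕ) =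
      if (j : ℕ) < k then 0 else ((α.toOrderHom j : Fin (r + 1)) : ℕ) + 1 := by
  change ((if (j : ℕ) < k then _ else _ : Fin (r + 2)) : ℕ) = _
  split_ifs <;> rfl

theorem comp_shiftFrom (β : ⦋m⦌ ⟶ ⦋n⦌) (α : ⦋n⦌ ⟶ ⦋r⦌) (k : ℕ) :
    β ≫ shiftFrom α k = shiftFrom (β ≫ α) (leastIndex β k) := by
  refine hom_ext' fun j => ?_
  have h := leastIndex_le_iff β k j
  rw [comp_apply', shiftFrom_apply, shiftFrom_apply, comp_apply']
  split_ifs <;> first | rfl | omega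

theorem shiftFrom_comp_δ (α : ⦋n⦌ ⟶ ⦋r⦌) (k : ℕ) (s : Fin (r + 1)) :
    shiftFrom α k ≫ SimplexCategory.δ s.succ.succ =
      shiftFrom (α ≫ SimplexCategory.δ s.succ) k := by
  refine hom_ext' fun j => ?_
  rw [comp_apply', δ_apply, shiftFrom_apply, shiftFrom_apply, comp_apply', δ_apply,
    Fin.val_succ s.succ, Fin.val_succ]
  split_ifs <;> omega

/-- The partial fiberwise integral of a form on `X × Δ^{r+1}`, over the first of the fiber
variables `t_1 ≥ … ≥ t_{r+1}` (from `t_2` to `ϑ`). It is a form on `X × Δ^r`; its value on a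
simplex is a sum over the intervals into which the variables of that simplex divide the domain of
integration. -/
def fiberPart (ω : Family (X ⊗ (Δ[r + 1] : SSet.{u}))) : Family (X ⊗ (Δ[r] : SSet.{u})) :=
  fun n z => ∑ i : Fin (n + 1),
    if (SSet.stdSimplex.objEquiv z.2).toOrderHom i = 0 then
      fiberStep i (ω (n + 1) (pairSimplex (X.map (SimplexCategory.σ i).op z.1)
        (shiftFrom (SimplexCategory.σ i ≫ SSet.stdSimplex.objEquiv z.2) (i + 1))))
    else 0

theorem fiberPart_apply (ω : Family (X ⊗ (Δ[r + 1] : SSet.{u}))) (x : X _⦋n⦌) (α : ⦋n⦌ ⟶ ⦋r⦌) :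
    fiberPart ω n (pairSimplex x α) = ∑ i : Fin (n + 1), if α.toOrderHom i = 0 then
      fiberStep i (ω (n + 1) (pairSimplex (X.map (SimplexCategory.σ i).op x)
        (shiftFrom (SimplexCategory.σ i ≫ α) (i + 1)))) else 0 := rfl

theorem IsForm.fiberPart {ω : Family (X ⊗ (Δ[r + 1] : SSet.{u}))} (hω : IsForm ω) :
    IsForm (fiberPart ω) := by
  intro m n β z
  obtain ⟨x, α, rfl⟩ := exists_pairSimplex z
  rw [map_pairSimplex, fiberPart_apply, fiberPart_apply, map_sum]
  have h : ∀ i : Fin (n + 1), pull β (if α.toOrderHom i = 0 then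
      fiberStep i (ω (n + 1) (pairSimplex (X.map (SimplexCategory.σ i).op x)
        (shiftFrom (SimplexCategory.σ i ≫ α) (i + 1)))) else 0) =
      ∑ i' : Fin (m + 1), if β.toOrderHom i' = i then (if α.toOrderHom i = 0 then
        fiberStep i' (ω (m + 1) (pairSimplex (X.map (SimplexCategory.σ i').op (X.map β.op x))
        (shiftFrom (SimplexCategory.σ i' ≫ β ≫ α) (i' + 1)))) else 0) else 0 := by
    intro i
    split_ifs with hα
    · rw [pull_fiberStep]
      refine Finset.sum_congr rfl fun i' _ => ?_
      split_ifs with hi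
      · subst hi
        rw [← hω, map_pairSimplex, comp_shiftFrom, leastIndex_doubleVertex, map_comp_apply',
          ← Category.assoc, doubleVertex_comp_σ, map_comp_apply', Category.assoc]
      · rfl
    · simp
  rw [Finset.sum_congr rfl fun i _ => h i, Finset.sum_comm]
  refine Finset.sum_congr rfl fun i' _ => ?_
  rw [Finset.sum_ite_eq, if_pos (Finset.mem_univ _)]
  rfl

/-- The restriction of a form on `X × Δ^{r+1}` to the face `X × d_s Δ^{r+1}`. -/
def facePull (s : Fin (r + 2)) (ω : Family (X ⊗ (Δ[r + 1] : SSet.{u}))) :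
    Family (X ⊗ (Δ[r] : SSet.{u})) :=
  pullback (X ◁ SSet.stdSimplex.map (SimplexCategory.δ s)) ω

theorem facePull_apply (s : Fin (r + 2)) (ω : Family (X ⊗ (Δ[r + 1] : SSet.{u}))) (x : X _⦋n⦌)
    (α : ⦋n⦌ ⟶ ⦋r⦌) :
    facePull s ω n (pairSimplex x α) = ω n (pairSimplex x (α ≫ SimplexCategory.δ s)) := rfl

theorem facePull_zero_fiberPart (ω : Family (X ⊗ (Δ[r + 2] : SSet.{u}))) :
    facePull 0 (fiberPart ω) = 0 := by
  refine family_ext fun n x α => ?_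
  rw [facePull_apply, fiberPart_apply]
  refine Finset.sum_eq_zero fun i _ => if_neg ?_
  exact Fin.succ_ne_zero _

theorem facePull_succ_fiberPart (s : Fin (r + 1)) (ω : Family (X ⊗ (Δ[r + 2] : SSet.{u}))) :
    facePull s.succ (fiberPart ω) = fiberPart (facePull s.succ.succ ω) := by
  refine family_ext fun n x α => ?_
  rw [facePull_apply, fiberPart_apply, fiberPart_apply]
  refine Finset.sum_congr rfl fun i _ => ?_
  have h : (α ≫ SimplexCategory.δ s.succ).toOrderHom i = 0 ↔ α.toOrderHom i = 0 := by
    have h1 := δ_apply s.succ (α.toOrderHom i)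
    rw [Fin.val_succ] at h1
    rw [Fin.ext_iff, Fin.ext_iff]
    change ((SimplexCategory.δ s.succ).toOrderHom (α.toOrderHom i) : ℕ) = 0 ↔
      (α.toOrderHom i : ℕ) = 0
    rw [h1]
    split_ifs
    · rfl
    · have : (α.toOrderHom i : ℕ) ≠ 0 := by omega
      simp [this]
  simp only [h]
  split_ifs
  · rw [facePull_apply, shiftFrom_comp_δ, Category.assoc]
  · rfl

/-- Integrating over one fiber variable, the boundary consists of the faces `t_1 = ϑ` and
`t_1 = t_2` of `Δ^{r+1}`. -/
theorem d_fiberPart {ω : Family (X ⊗ (Δ[r + 1] : SSet.{u}))} (hω : IsForm ω) :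
    d (fiberPart ω) = facePull 0 ω - facePull 1 ω - fiberPart (d ω) := by
  rw [eq_sub_iff_add_eq]
  refine family_ext fun n x α => ?_
  change dOmega n (fiberPart ω n _) + fiberPart (d ω) n _ = facePull 0 ω n _ - facePull 1 ω n _
  rw [fiberPart_apply, fiberPart_apply, map_sum, ← Finset.sum_add_distrib, facePull_apply,
    facePull_apply]
  have h0 : α ≫ SimplexCategory.δ 0 = shiftFrom α (leastIndex α (0 : Fin (r + 1))) := by
    refine hom_ext' fun j => ?_
    have h := leastIndex_zero α
    rw [comp_apply', δ_apply, shiftFrom_apply]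
    simp [h]
  have h1 : α ≫ SimplexCategory.δ 1 = shiftFrom α (leastIndex α ((0 : Fin (r + 1)) + 1)) := by
    refine hom_ext' fun j => ?_
    have h := leastIndex_le_iff α 1 j
    rw [comp_apply', δ_apply, shiftFrom_apply]
    have h1 : ((1 : Fin (r + 2)) : ℕ) = 1 := rfl
    simp only [Fin.val_zero, zero_add]
    by_cases hj : leastIndex α 1 ≤ j
    · rw [if_neg (by omega), if_neg (by omega)]
    · rw [if_pos (by omega), if_pos (by omega)]
      omega
  rw [h0, h1, ← sum_telescope α 0 fun k => ω n (pairSimplex x (shiftFrom α k))]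
  refine Finset.sum_congr rfl fun i _ => ?_
  split_ifs with hi
  · change _ + fiberStep i (dOmega (n + 1) _) = _
    rw [dOmega_fiberStep, ← hω, ← hω, map_pairSimplex, map_pairSimplex, map_comp_apply',
      map_comp_apply', comp_shiftFrom, comp_shiftFrom, ← Category.assoc, ← Category.assoc,
      SimplexCategory.δ_comp_σ_self, SimplexCategory.δ_comp_σ_succ, map_id_apply',
      Category.id_comp, leastIndex_δ _ _ (by omega), leastIndex_δ _ _ (by omega), if_neg (by simp),
      if_pos (by simp), Nat.add_sub_cancel]
  · rw [map_zero, add_zero]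

theorem fiberPart_mul_pullback (ω : Family (X ⊗ (Δ[r + 1] : SSet.{u}))) {γ : Family X}
    (hγ : IsForm γ) :
    fiberPart (ω * pullback (CartesianMonoidalCategory.fst _ _) γ) =
      fiberPart ω * pullback (CartesianMonoidalCategory.fst _ _) γ := by
  refine family_ext fun n x α => ?_
  change _ = fiberPart ω n _ * γ n x
  rw [fiberPart_apply, fiberPart_apply, Finset.sum_mul]
  refine Finset.sum_congr rfl fun i _ => ?_
  split_ifs
  · change fiberStep i (ω _ _ * γ _ (X.map (SimplexCategory.σ i).op x)) = _
    rw [hγ, fiberStep_mul_pull]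
  · rw [zero_mul]

theorem fiberPart_pullback_mul (ω : Family (X ⊗ (Δ[r + 1] : SSet.{u}))) {γ : Family X}
    (hγ : IsForm γ) {p : ℕ} (hp : IsHomogeneous p γ) :
    fiberPart (pullback (CartesianMonoidalCategory.fst _ _) γ * ω) =
      (-1 : ℤ) ^ p • (pullback (CartesianMonoidalCategory.fst _ _) γ * fiberPart ω) := by
  refine family_ext fun n x α => ?_
  change _ = (-1 : ℤ) ^ p • (γ n x * fiberPart ω n _)
  rw [fiberPart_apply, fiberPart_apply, Finset.mul_sum, Finset.smul_sum]
  refine Finset.sum_congr rfl fun i _ => ?_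
  split_ifs
  · change fiberStep i (γ _ (X.map (SimplexCategory.σ i).op x) * ω _ _) = _
    rw [hγ, fiberStep_pull_mul]
    rw [← hγ]
    exact hp _ _
  · rw [mul_zero, smul_zero]

end ProductForms

/-! ### Maximal chains -/

section Chains

variable {n r : ℕ}

theorem MaxChain.toBase_apply (Γ : MaxChain n r) (j : Fin (n + r + 1)) :
    Γ.toBase.toOrderHom j = (Γ j).1 := rfl

theorem MaxChain.toFiber_apply (Γ : MaxChain n r) (j : Fin (n + r + 1)) :
    Γ.toFiber.toOrderHom j = (Γ j).2 := rfl

/-- Every step of a maximal chain increases exactly one of the coordinates, and by `1`. -/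
theorem MaxChain.add_eq (Γ : MaxChain n r) (j : Fin (n + r + 1)) :
    ((Γ j).1 : ℕ) + (Γ j).2 = j := by
  let g : Fin (n + r + 1) → Fin (n + r + 1) := fun j => ⟨(Γ j).1 + (Γ j).2, by omega⟩
  have hg : StrictMono g := by
    intro a b hab
    have h := Γ.strictMono hab
    rw [Prod.lt_iff] at h
    rw [Fin.lt_def]
    simp only [Fin.lt_def, Fin.le_def] at h
    change ((Γ a).1 : ℕ) + (Γ a).2 < (Γ b).1 + (Γ b).2
    omega
  have h1 := hg.le_apply (x := j)
  have h2 := hg.apply_le (x := j)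
  exact congrArg Fin.val (le_antisymm h2 h1)

/-- The maximal chain with given components. -/
def MaxChain.mk (b : ⦋n + r⦌ ⟶ ⦋n⦌) (f : ⦋n + r⦌ ⟶ ⦋r⦌)
    (h : ∀ j : Fin (n + r + 1), ((b.toOrderHom j : Fin (n + 1)) : ℕ) +
      (f.toOrderHom j : Fin (r + 1)) = j) : MaxChain n r :=
  OrderEmbedding.ofStrictMono (fun j => (b.toOrderHom j, f.toOrderHom j)) fun i j hij => by
    refine lt_of_le_of_ne ⟨b.toOrderHom.monotone hij.le, f.toOrderHom.monotone hij.le⟩ fun he => ?_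
    have h1 := congrArg (fun p : Fin (n + 1) × Fin (r + 1) => (p.1 : ℕ) + p.2) he
    simp only at h1
    rw [h, h] at h1
    exact hij.ne (Fin.ext h1)

/-- A maximal chain is determined by its second component. -/
theorem MaxChain.ext_toFiber {Γ Γ' : MaxChain n r} (h : Γ.toFiber = Γ'.toFiber) : Γ = Γ' := by
  refine DFunLike.ext _ _ fun j => ?_
  have h2 : (Γ j).2 = (Γ' j).2 := by rw [← MaxChain.toFiber_apply, h]; rfl
  have h3 := Γ.add_eq j
  have h4 := Γ'.add_eq j
  rw [h2] at h3
  exact Prod.ext (Fin.ext (by omega)) h2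

theorem sInf_eq_leastIndex {m : ℕ} (α : ⦋m⦌ ⟶ ⦋n⦌) (k : Fin (n + 1))
    (hk : ∃ j, k ≤ α.toOrderHom j) :
    ((sInf {j | k ≤ α.toOrderHom j} : Fin (m + 1)) : ℕ) = leastIndex α k := by
  obtain ⟨j, hj⟩ := hk
  have hne : ({j | k ≤ α.toOrderHom j} : Set (Fin (m + 1))).Nonempty := ⟨j, hj⟩
  have hmem := csInf_mem hne
  refine le_antisymm ?_ ((leastIndex_le_iff α k _).2 hmem)
  have hlt : leastIndex α k < m + 1 := lt_of_le_of_lt ((leastIndex_le_iff α k j).2 hj) j.2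
  have h : (⟨_, hlt⟩ : Fin (m + 1)) ∈ {j | k ≤ α.toOrderHom j} :=
    (leastIndex_le_iff α k ⟨_, hlt⟩).1 le_rfl
  exact csInf_le' h

theorem MaxChain.apply_last (Γ : MaxChain n r) :
    ((Γ (Fin.last _)).1 : ℕ) = n ∧ ((Γ (Fin.last _)).2 : ℕ) = r := by
  have h := Γ.add_eq (Fin.last _)
  rw [Fin.val_last] at h
  omega

theorem MaxChain.val_fiber (Γ : MaxChain n r) (k : Fin (r + 1)) :
    (Γ.fiber k : ℕ) = leastIndex Γ.toFiber k :=
  sInf_eq_leastIndex Γ.toFiber k ⟨Fin.last _, by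
    rw [Fin.le_def, MaxChain.toFiber_apply, Γ.apply_last.2]; omega⟩

theorem MaxChain.val_base (Γ : MaxChain n r) (k : Fin (n + 1)) :
    (Γ.base.toOrderHom k : Fin (n + r + 1)) = leastIndex Γ.toBase k :=
  sInf_eq_leastIndex Γ.toBase k ⟨Fin.last _, by
    rw [Fin.le_def, MaxChain.toBase_apply, Γ.apply_last.1]; omega⟩

/-- The numbers `f_Γ(k) - k` increase weakly with `k`. -/
theorem MaxChain.fiber_add_le (Γ : MaxChain n r) {a b : Fin (r + 1)} (h : a ≤ b) :
    (Γ.fiber a : ℕ) + (b - a) ≤ Γ.fiber b := by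
  have h1 : (b : ℕ) ≤ (Γ (Γ.fiber b)).2 :=
    (leastIndex_le_iff Γ.toFiber b (Γ.fiber b)).1 (Γ.val_fiber b).ge
  have h2 := Γ.add_eq (Γ.fiber b)
  have h3 : (a : ℕ) ≤ b := h
  have hq : (Γ.fiber b : ℕ) - (b - a) < n + r + 1 := by omega
  have h4 := Γ.add_eq ⟨_, hq⟩
  have h5 : ((Γ ⟨_, hq⟩).1 : ℕ) ≤ (Γ (Γ.fiber b)).1 :=
    (Γ.monotone (show (⟨_, hq⟩ : Fin (n + r + 1)) ≤ Γ.fiber b from Nat.sub_le _ _)).1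
  have h6 := (leastIndex_le_iff Γ.toFiber a ⟨_, hq⟩).2 (by
    rw [MaxChain.toFiber_apply]; simp only at h4; omega)
  rw [Γ.val_fiber a]
  simp only at h6
  omega

theorem leastIndex_shiftFrom {m : ℕ} (α : ⦋m⦌ ⟶ ⦋r⦌) (k a : ℕ) (hk : k ≤ m + 1) :
    leastIndex (shiftFrom α k) (a + 1) = max k (leastIndex α a) := by
  refine leastIndex_eq _ _ _ (max_le hk (leastIndex_le _ _)) fun j => ?_
  rw [shiftFrom_apply, max_le_iff, leastIndex_le_iff]
  split_ifs <;> omega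

/-- The maximal chain in `[n] × [r + 1]` obtained from one in `[n] × [r]` by doubling a vertex `i`
in the bottom row and moving the second copy of it, and all later vertices, up by one. -/
def MaxChain.insertStep (Γ : MaxChain n r) (i : Fin (n + r + 1))
    (hi : Γ.toFiber.toOrderHom i = 0) : MaxChain n (r + 1) :=
  MaxChain.mk (r := r + 1) (SimplexCategory.σ i ≫ Γ.toBase)
    (shiftFrom (SimplexCategory.σ i ≫ Γ.toFiber) (i + 1)) fun j => by
    have h1 := shiftFrom_apply (SimplexCategory.σ i ≫ Γ.toFiber) (i + 1) j
    have h2 := σ_apply i j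
    have h3 := Γ.add_eq ((SimplexCategory.σ i).toOrderHom j)
    have h4 : ((Γ i).2 : ℕ) = 0 := congrArg Fin.val hi
    rw [comp_apply', MaxChain.toFiber_apply] at h1
    refine (congrArg (((Γ ((SimplexCategory.σ i).toOrderHom j)).1 : ℕ) + ·) h1).trans ?_
    dsimp only
    split_ifs at h2 ⊢ with h5 h6 h6
    · have h7 : ((Γ ((SimplexCategory.σ i).toOrderHom j)).2 : ℕ) ≤ (Γ i).2 :=
        (Γ.monotone (show (SimplexCategory.σ i).toOrderHom j ≤ i by
          rw [Fin.le_def, h2]; exact h6)).2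
      omega
    · omega
    · omega
    · omega

theorem MaxChain.toFiber_insertStep (Γ : MaxChain n r) (i : Fin (n + r + 1)) (hi) :
    (Γ.insertStep i hi).toFiber = shiftFrom (SimplexCategory.σ i ≫ Γ.toFiber) (i + 1) := rfl

theorem MaxChain.toBase_insertStep (Γ : MaxChain n r) (i : Fin (n + r + 1)) (hi) :
    (Γ.insertStep i hi).toBase = SimplexCategory.σ i ≫ Γ.toBase := rfl

theorem MaxChain.leastIndex_toFiber_bounds (Γ : MaxChain n (r + 1)) :
    0 < leastIndex Γ.toFiber 1 ∧ leastIndex Γ.toFiber 1 ≤ n + r + 1 := by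
  constructor
  · by_contra h
    have h1 := (leastIndex_le_iff Γ.toFiber 1 0).1 (by omega)
    have h2 := Γ.add_eq 0
    rw [MaxChain.toFiber_apply] at h1
    simp only [Fin.val_zero] at h2
    omega
  · refine (leastIndex_le_iff Γ.toFiber 1 (Fin.last _)).2 ?_
    rw [MaxChain.toFiber_apply, Γ.apply_last.2]
    omega

/-- The last vertex of a maximal chain in the bottom row. -/
def MaxChain.lastBottom (Γ : MaxChain n (r + 1)) : Fin (n + r + 1) :=
  ⟨leastIndex Γ.toFiber 1 - 1, by have := Γ.leastIndex_toFiber_bounds; omega⟩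

theorem MaxChain.val_lastBottom (Γ : MaxChain n (r + 1)) :
    (Γ.lastBottom : ℕ) + 1 = leastIndex Γ.toFiber 1 := by
  have := Γ.leastIndex_toFiber_bounds
  change leastIndex Γ.toFiber 1 - 1 + 1 = _
  omega

/-- The inverse of `MaxChain.insertStep`. -/
def MaxChain.removeStep (Γ : MaxChain n (r + 1)) : MaxChain n r :=
  MaxChain.mk (SimplexCategory.δ Γ.lastBottom.succ ≫ Γ.toBase)
    (SimplexCategory.δ Γ.lastBottom.succ ≫ Γ.toFiber ≫ SimplexCategory.σ 0) fun j => by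
    have h1 := σ_apply (0 : Fin (r + 1))
      (Γ.toFiber.toOrderHom ((SimplexCategory.δ Γ.lastBottom.succ).toOrderHom j))
    have h2 := δ_apply Γ.lastBottom.succ j
    have h3 := Γ.add_eq ((SimplexCategory.δ Γ.lastBottom.succ).toOrderHom j)
    have h4 := leastIndex_le_iff Γ.toFiber 1
      ((SimplexCategory.δ Γ.lastBottom.succ).toOrderHom j)
    rw [← Γ.val_lastBottom] at h4
    rw [MaxChain.toFiber_apply] at h1 h4
    rw [Fin.val_succ] at h2
    refine (congrArg (((Γ ((SimplexCategory.δ Γ.lastBottom.succ).toOrderHom j)).1 : ℕ) + ·)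
      h1).trans ?_
    dsimp only
    rw [Fin.val_zero]
    split_ifs at h2 ⊢ <;> omega

theorem MaxChain.toFiber_removeStep (Γ : MaxChain n (r + 1)) :
    Γ.removeStep.toFiber =
      SimplexCategory.δ Γ.lastBottom.succ ≫ Γ.toFiber ≫ SimplexCategory.σ 0 := rfl

theorem MaxChain.toFiber_removeStep_lastBottom (Γ : MaxChain n (r + 1)) :
    Γ.removeStep.toFiber.toOrderHom Γ.lastBottom = 0 := by
  have h1 := σ_apply (0 : Fin (r + 1))
    (Γ.toFiber.toOrderHom ((SimplexCategory.δ Γ.lastBottom.succ).toOrderHom Γ.lastBottom))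
  have h2 := δ_apply Γ.lastBottom.succ Γ.lastBottom
  have h4 := leastIndex_le_iff Γ.toFiber 1
    ((SimplexCategory.δ Γ.lastBottom.succ).toOrderHom Γ.lastBottom)
  rw [← Γ.val_lastBottom] at h4
  rw [Fin.val_succ, if_pos (Nat.lt_succ_self _)] at h2
  refine Fin.ext (h1.trans ?_)
  rw [Fin.val_zero]
  split_ifs <;> omega

theorem MaxChain.insertStep_removeStep (Γ : MaxChain n (r + 1)) :
    Γ.removeStep.insertStep Γ.lastBottom Γ.toFiber_removeStep_lastBottom = Γ := by
  refine MaxChain.ext_toFiber (hom_ext' fun j => ?_)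
  rw [MaxChain.toFiber_insertStep, shiftFrom_apply, MaxChain.toFiber_removeStep, comp_apply',
    comp_apply', comp_apply', σ_apply (0 : Fin (r + 1))]
  have h1 := σ_apply Γ.lastBottom j
  have h2 := δ_apply Γ.lastBottom.succ ((SimplexCategory.σ Γ.lastBottom).toOrderHom j)
  have h3 := leastIndex_le_iff Γ.toFiber 1 j
  rw [← Γ.val_lastBottom] at h3
  rw [Fin.val_succ] at h2
  rw [Fin.val_zero]
  by_cases hj : (j : ℕ) < Γ.lastBottom + 1
  · rw [if_pos hj]
    omega
  · rw [if_neg hj]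
    rw [if_neg (by omega)] at h1
    by_cases hj' : (j : ℕ) = Γ.lastBottom + 1
    · rw [if_pos (by omega)] at h2
      have h4 := leastIndex_le_iff Γ.toFiber 1 ((SimplexCategory.δ Γ.lastBottom.succ).toOrderHom
        ((SimplexCategory.σ Γ.lastBottom).toOrderHom j))
      rw [← Γ.val_lastBottom] at h4
      have h5 := Γ.add_eq j
      have h6 := Γ.add_eq ((SimplexCategory.δ Γ.lastBottom.succ).toOrderHom
        ((SimplexCategory.σ Γ.lastBottom).toOrderHom j))
      have h7 := toOrderHom_le Γ.toBase (b := j) (a :=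
        ((SimplexCategory.δ Γ.lastBottom.succ).toOrderHom
          ((SimplexCategory.σ Γ.lastBottom).toOrderHom j))) (by omega)
      have h8 : (Γ.toFiber.toOrderHom ((SimplexCategory.δ Γ.lastBottom.succ).toOrderHom
        ((SimplexCategory.σ Γ.lastBottom).toOrderHom j)) : ℕ) = 0 := by omega
      rw [if_pos h8.le, h8]
      simp only [MaxChain.toFiber_apply, MaxChain.toBase_apply] at h3 h7 h8 ⊢
      omega
    · rw [if_neg (by omega)] at h2
      have h4 : (SimplexCategory.δ Γ.lastBottom.succ).toOrderHom
        ((SimplexCategory.σ Γ.lastBottom).toOrderHom j) = j := Fin.ext (by omega)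
      rw [h4]
      split_ifs <;> omega

theorem MaxChain.lastBottom_insertStep (Γ : MaxChain n r) (i : Fin (n + r + 1)) (hi) :
    (Γ.insertStep i hi).lastBottom = i := by
  refine Fin.ext (Nat.succ_injective ?_)
  refine (MaxChain.val_lastBottom _).trans ?_
  rw [MaxChain.toFiber_insertStep, leastIndex_shiftFrom _ _ 0 (by omega), leastIndex_zero]
  simp

theorem MaxChain.removeStep_insertStep (Γ : MaxChain n r) (i : Fin (n + r + 1)) (hi) :
    (Γ.insertStep i hi).removeStep = Γ := by
  refine MaxChain.ext_toFiber (hom_ext' fun j => ?_)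
  rw [MaxChain.toFiber_removeStep, MaxChain.lastBottom_insertStep, MaxChain.toFiber_insertStep,
    ← Category.assoc, comp_shiftFrom, ← Category.assoc, SimplexCategory.δ_comp_σ_succ,
    Category.id_comp, leastIndex_δ _ _ (by omega), if_pos (by simp), comp_apply',
    σ_apply (0 : Fin (r + 1)), shiftFrom_apply]
  have h1 := toOrderHom_le Γ.toFiber (a := j) (b := i)
  have h2 : ((Γ.toFiber.toOrderHom i : Fin (r + 1)) : ℕ) = 0 := congrArg Fin.val hi
  rw [Fin.val_zero]
  split_ifs <;> omega

/-! ### Fiberwise integration, one variable at a time -/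

theorem integrateStep_comp_pull_σ {N : ℕ} (i l : Fin (N + 1)) (h : i < l) (a b : ℕ) :
    integrateStep l.succ (leastIndex (SimplexCategory.σ i) a)
        (leastIndex (SimplexCategory.σ i) b) ∘ₗ pull (SimplexCategory.σ i) =
      pull (SimplexCategory.σ i) ∘ₗ integrateStep l a b := by
  rcases N with _ | N
  · omega
  obtain ⟨l, rfl⟩ := Fin.exists_succ_eq.2 (Fin.ne_zero_of_lt h)
  obtain ⟨i, rfl⟩ := Fin.exists_castSucc_eq.2 (ne_of_lt (h.trans_le (Fin.le_last _)))
  have hil : i ≤ l := Fin.castSucc_lt_succ_iff.1 h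
  have hl : leastIndex (SimplexCategory.σ i.castSucc) (l + 1) = l.succ + 1 := by
    have h' : (i : ℕ) ≤ l := hil
    rw [leastIndex_σ _ _ (by omega), Fin.val_succ, if_neg]
    rw [Fin.val_castSucc]
    omega
  have hσ : ∀ η : Omega N, pull (SimplexCategory.σ i.castSucc) (pull (SimplexCategory.σ l) η) =
      pull (SimplexCategory.σ l.succ) (pull (SimplexCategory.σ i) η) := fun η => by
    rw [← pull_comp, SimplexCategory.σ_comp_σ hil, pull_comp]
  refine omega_hom_ext_split l (fun η s => ?_) fun η s => ?_
  · rw [LinearMap.comp_apply, LinearMap.comp_apply, integrateStep_pull_σ, map_zero, pull_mul,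
      pull_ypow, hσ, hl, integrateStep_pull_σ]
  · rw [LinearMap.comp_apply, LinearMap.comp_apply, integrateStep_dX_mul, pull_mul, pull_mul,
      pull_ypow, pull_dX, hσ, hl, integrateStep_dX_mul, pull_mul, hσ, map_sub, pull_ypow, pull_ypow]

/-- Integrating along `x_{i+1}` between its two neighbours yields a form that does not involve
`x_{i+1}`. -/
theorem integrateStep_eq (i : Fin (n + 1)) :
    integrateStep i.succ (i + 2) i = pull (SimplexCategory.σ i) ∘ₗ fiberStep i := by
  refine omega_hom_ext_split i (fun η s => ?_) fun η s => ?_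
  · rw [LinearMap.comp_apply, integrateStep_pull_σ, fiberStep_pull_σ, map_zero]
  · rw [LinearMap.comp_apply, integrateStep_dX_mul, fiberStep_dX_mul, pull_mul, map_sub, pull_ypow,
      pull_ypow, leastIndex_σ _ _ (by omega), leastIndex_σ _ _ (by omega), if_pos le_rfl,
      if_neg (by omega)]

theorem composeList_zero {M : Type} [AddCommGroup M] (T : Fin 0 → Module.End ℤ M) :
    composeList T = 1 := by
  simp [composeList]

theorem composeList_succ {M : Type} [AddCommGroup M] {r : ℕ} (T : Fin (r + 1) → Module.End ℤ M) :
    composeList T = composeList (fun k : Fin r => T k.succ) ∘ₗ T 0 := by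
  simp [composeList, List.ofFn_succ, List.prod_append]
  rfl

theorem composeList_comp {M N : Type} [AddCommGroup M] [AddCommGroup N] (S : M →ₗ[ℤ] N) {r : ℕ}
    (T : Fin r → Module.End ℤ N) (T' : Fin r → Module.End ℤ M)
    (h : ∀ k, T k ∘ₗ S = S ∘ₗ T' k) : composeList T ∘ₗ S = S ∘ₗ composeList T' := by
  induction r with
  | zero => rw [composeList_zero, composeList_zero]; rfl
  | succ r ih =>
    rw [composeList_succ, composeList_succ, LinearMap.comp_assoc, h, ← LinearMap.comp_assoc,
      ih _ _ fun k => h k.succ, LinearMap.comp_assoc]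

theorem map_composeList {r : ℕ} (S : Fin r → Module.End ℤ (ExteriorAlgebra ℤ (Diff n)))
    (T : Fin r → Module.End ℤ (Fun n)) (η : Omega n) :
    TensorProduct.map (composeList S) (composeList T) η =
      composeList (M := Omega n) (fun k => TensorProduct.map (S k) (T k)) η := by
  induction r generalizing η with
  | zero =>
    rw [composeList_zero, composeList_zero]
    exact (DFunLike.congr_fun TensorProduct.map_id η).trans
      (DFunLike.congr_fun (composeList_zero (M := Omega n) _) η).symm
  | succ r ih =>
    rw [composeList_succ, composeList_succ]
    refine ((DFunLike.congr_fun (TensorProduct.map_comp _ _ _ _) η).trans ?_).trans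
      (DFunLike.congr_fun (composeList_succ (M := Omega n) _) η).symm
    exact ih _ _ _

theorem MaxChain.integrate_apply (Γ : MaxChain n r) (η : Omega (n + r)) :
    Γ.integrate η = pull Γ.base (composeList (M := Omega (n + r)) (fun k : Fin r =>
      integrateStep (Γ.fiber k.succ) ((Γ.fiber k.succ : ℕ) + 1) (Γ.upper k.succ)) η) :=
  congrArg (pull Γ.base) (map_composeList _ _ η)

theorem MaxChain.base_insertStep (Γ : MaxChain n r) (i : Fin (n + r + 1)) (hi) :
    (Γ.insertStep i hi).base ≫ SimplexCategory.σ i = Γ.base := by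
  refine hom_ext' fun k => ?_
  have h1 := (Γ.insertStep i hi).val_base k
  have h2 := Γ.val_base k
  have h3 := (Γ.base.toOrderHom k).2
  have h4 := σ_apply i ((Γ.insertStep i hi).base.toOrderHom k)
  change _ < n + r + 1 at h3
  rw [MaxChain.toBase_insertStep, leastIndex_comp, ← h2, leastIndex_σ _ _ (by omega)] at h1
  rw [comp_apply']
  split_ifs at h1 h4 <;> omega

theorem MaxChain.fiber_insertStep_one (Γ : MaxChain n r) (i : Fin (n + r + 1)) (hi) :
    (Γ.insertStep i hi).fiber (Fin.succ 0) = i.succ := by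
  refine Fin.ext ?_
  rw [MaxChain.val_fiber, Fin.val_succ, Fin.val_succ, Fin.val_zero]
  refine (MaxChain.val_lastBottom _).symm.trans ?_
  rw [MaxChain.lastBottom_insertStep]

/-- The vertices up to `i` lie in the bottom row, so they precede all fiber steps. -/
theorem MaxChain.lt_fiber (Γ : MaxChain n r) (i : Fin (n + r + 1))
    (hi : Γ.toFiber.toOrderHom i = 0) (k : Fin r) : i < Γ.fiber k.succ := by
  have h1 := leastIndex_le_iff Γ.toFiber k.succ i
  have h2 : ((Γ.toFiber.toOrderHom i : Fin (r + 1)) : ℕ) = 0 := congrArg Fin.val hi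
  rw [Fin.lt_def, MaxChain.val_fiber]
  rw [Fin.val_succ] at h1 ⊢
  omega

theorem MaxChain.fiber_insertStep_succ (Γ : MaxChain n r) (i : Fin (n + r + 1)) (hi) (k : Fin r) :
    (Γ.insertStep i hi).fiber k.succ.succ = (Γ.fiber k.succ).succ := by
  refine Fin.ext ?_
  have h1 : (i : ℕ) < Γ.fiber k.succ := Γ.lt_fiber i hi k
  have h2 := (Γ.fiber k.succ).2
  rw [MaxChain.val_fiber, MaxChain.toFiber_insertStep, Fin.val_succ k.succ,
    leastIndex_shiftFrom _ _ _ (by omega), leastIndex_comp, ← MaxChain.val_fiber,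
    leastIndex_σ _ _ (by omega), if_neg (by omega), Fin.val_succ]
  omega

/-- If `j` is the first fiber step of the block of consecutive fiber steps that contains the `k`-th
one, then the upper limit of the `k`-th integration is the vertex at which that block starts. -/
theorem MaxChain.upper_eq (Γ : MaxChain n r) (k j : Fin (r + 1)) (h1 : 1 ≤ (j : ℕ))
    (h2 : (Γ.fiber j : ℕ) + k = Γ.fiber k + j)
    (h3 : ∀ j' : Fin (r + 1), 1 ≤ (j' : ℕ) → (Γ.fiber j' : ℕ) + k = Γ.fiber k + j' → j ≤ j') :
    Γ.upper k = Γ.fiber j - 1 := by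
  have : sInf {j | 1 ≤ ((j : Fin (r + 1)) : ℕ) ∧
      ((Γ.fiber j : ℕ) : ℤ) - (j : ℕ) = ((Γ.fiber k : ℕ) : ℤ) - (k : ℕ)} = j := by
    refine le_antisymm (csInf_le' ⟨h1, by omega⟩) (le_csInf ⟨j, h1, by omega⟩ ?_)
    rintro j' ⟨h4, h5⟩
    exact h3 j' h4 (by omega)
  rw [MaxChain.upper, this]

theorem MaxChain.upper_insertStep_one (Γ : MaxChain n r) (i : Fin (n + r + 1)) (hi) :
    (Γ.insertStep i hi).upper (Fin.succ 0) = i := by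
  rw [(Γ.insertStep i hi).upper_eq (Fin.succ 0) (Fin.succ 0) (by simp) rfl,
    Γ.fiber_insertStep_one, Fin.val_succ, Nat.add_sub_cancel]
  intro j' h _
  rw [Fin.le_def]
  simpa using h

/-- Every block of consecutive fiber steps has a first element, which computes its upper limit. -/
theorem MaxChain.exists_upper (Γ : MaxChain n r) (k : Fin r) :
    ∃ j : Fin r, (Γ.fiber j.succ : ℕ) + k.succ = Γ.fiber k.succ + j.succ ∧
      Γ.upper k.succ = Γ.fiber j.succ - 1 ∧
      ∀ j' : Fin r, (Γ.fiber j'.succ : ℕ) + k.succ = Γ.fiber k.succ + j'.succ → j ≤ j' := by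
  classical
  obtain ⟨j, hj, hmin⟩ := Set.exists_min_image
    {j | (Γ.fiber j.succ : ℕ) + k.succ = Γ.fiber k.succ + j.succ} id (Set.toFinite _)
    (Set.nonempty_of_mem (x := k) (by rw [Set.mem_ofPred_eq]))
  refine ⟨j, hj, Γ.upper_eq _ _ (by simp) hj fun j' h1 h2 => ?_, fun j' h => hmin j' h⟩
  obtain ⟨j', rfl⟩ := Fin.exists_succ_eq.2 (show j' ≠ 0 by rintro rfl; simp at h1)
  exact Fin.succ_le_succ_iff.2 (hmin j' h2)

/-- The upper limits of integration before and after the insertion of a step differ only by the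
renaming of variables: if the `(k + 1)`-st fiber step of `Γ` belongs to a block of consecutive fiber
steps that starts at the vertex `i`, then the new step becomes the first one of that block. -/
theorem MaxChain.upper_insertStep_succ (Γ : MaxChain n r) (i : Fin (n + r + 1)) (hi) (k : Fin r) :
    (Γ.insertStep i hi).upper k.succ.succ = leastIndex (SimplexCategory.σ i) (Γ.upper k.succ) := by
  obtain ⟨j, h1, h2, h3⟩ := Γ.exists_upper k
  have hj : (i : ℕ) < Γ.fiber j.succ := Γ.lt_fiber i hi j
  have hk : (i : ℕ) < Γ.fiber k.succ := Γ.lt_fiber i hi k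
  have hjlt := (Γ.fiber j.succ).2
  have hone := congrArg Fin.val (Γ.fiber_insertStep_one i hi)
  rw [Fin.val_succ] at hone
  have hsucc : ∀ l : Fin r, ((Γ.insertStep i hi).fiber l.succ.succ : ℕ) = Γ.fiber l.succ + 1 :=
    fun l => congrArg Fin.val (Γ.fiber_insertStep_succ i hi l)
  rw [h2, leastIndex_σ _ _ (by omega)]
  have hr : 0 < r := k.pos
  have hlow : ∀ l : Fin r, (Γ.fiber (Fin.succ ⟨0, hr⟩) : ℕ) + l ≤ Γ.fiber l.succ := fun l => by
    have h := Γ.fiber_add_le (a := Fin.succ ⟨0, hr⟩) (b := l.succ)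
      (Fin.succ_le_succ_iff.2 (Nat.zero_le _))
    rw [Fin.val_succ, Fin.val_succ] at h
    simpa using h
  have h0 : (i : ℕ) < Γ.fiber (Fin.succ ⟨0, hr⟩) := Γ.lt_fiber i hi _
  have hlj := hlow j
  have hlk := hlow k
  simp only [Fin.val_succ] at h1 h3
  by_cases hc : (Γ.fiber k.succ : ℕ) = k + 1 + i
  · have hj0 : (j : ℕ) ≤ 0 := h3 ⟨0, hr⟩ (by simp only; omega)
    rw [if_pos (by omega), (Γ.insertStep i hi).upper_eq k.succ.succ (Fin.succ 0) (by simp)]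
    · omega
    · rw [hone, hsucc]
      simp only [Fin.val_succ, Fin.val_zero]
      omega
    · intro j' h _
      rw [Fin.le_def]
      simpa using h
  · rw [if_neg (by omega), (Γ.insertStep i hi).upper_eq k.succ.succ j.succ.succ (by simp)]
    · rw [hsucc]
      omega
    · rw [hsucc, hsucc]
      simp only [Fin.val_succ]
      omega
    · intro j' h h'
      obtain ⟨j', rfl⟩ := Fin.exists_succ_eq.2 (show j' ≠ 0 by rintro rfl; simp at h)
      refine Fin.succ_le_succ_iff.2 ?_
      rcases Fin.eq_zero_or_eq_succ j' with rfl | ⟨j', rfl⟩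
      · rw [hone, hsucc] at h'
        simp only [Fin.val_succ, Fin.val_zero] at h'
        omega
      · rw [hsucc, hsucc] at h'
        simp only [Fin.val_succ] at h'
        exact Fin.succ_le_succ_iff.2 (h3 j' (by omega))

theorem MaxChain.integrate_insertStep (Γ : MaxChain n r) (i : Fin (n + r + 1)) (hi)
    (η : Omega (n + r + 1)) :
    (Γ.insertStep i hi).integrate η = Γ.integrate (fiberStep i η) := by
  rw [MaxChain.integrate_apply, MaxChain.integrate_apply, composeList_succ, LinearMap.comp_apply]
  have h0 : integrateStep ((Γ.insertStep i hi).fiber (Fin.succ 0))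
      (((Γ.insertStep i hi).fiber (Fin.succ 0) : ℕ) + 1)
        ((Γ.insertStep i hi).upper (Fin.succ 0)) η =
      pull (SimplexCategory.σ i) (fiberStep i η) := by
    rw [Γ.fiber_insertStep_one, Γ.upper_insertStep_one]
    exact DFunLike.congr_fun (integrateStep_eq i) η
  have h1 := composeList_comp (M := Omega (n + r)) (N := Omega (n + r + 1))
    (pull (SimplexCategory.σ i))
    (fun k : Fin r => integrateStep ((Γ.insertStep i hi).fiber k.succ.succ)
      (((Γ.insertStep i hi).fiber k.succ.succ : ℕ) + 1) ((Γ.insertStep i hi).upper k.succ.succ))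
    (fun k => integrateStep (Γ.fiber k.succ) ((Γ.fiber k.succ : ℕ) + 1) (Γ.upper k.succ)) ?_
  · refine (congrArg _ ((congrArg _ h0).trans (DFunLike.congr_fun h1 (fiberStep i η)))).trans ?_
    rw [← Γ.base_insertStep i hi, pull_comp]
    rfl
  · intro k
    have h2 : (i : ℕ) < Γ.fiber k.succ := Γ.lt_fiber i hi k
    rw [← integrateStep_comp_pull_σ i _ (Γ.lt_fiber i hi k), Γ.fiber_insertStep_succ,
      Γ.upper_insertStep_succ, leastIndex_σ i (Γ.fiber k.succ + 1) (by omega), if_neg (by omega),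
      Fin.val_succ]

end Chains

section FiberIntegral

variable {X : SSet.{u}} {n r : ℕ}

theorem restrict_eq (ω : Family (X ⊗ (Δ[r] : SSet.{u}))) (x : X _⦋n⦌) (Γ : MaxChain n r) :
    restrict ω x Γ = ω (n + r) (pairSimplex (X.map Γ.toBase.op x) Γ.toFiber) := rfl

/-- Fubini: fiberwise integration along `X × Δ^{r+1}` is integration over the first fiber variable,
followed by fiberwise integration along `X × Δ^r`. -/
theorem fiberIntegral_succ (ω : Family (X ⊗ (Δ[r + 1] : SSet.{u}))) :
    fiberIntegral (r + 1) ω = fiberIntegral r (fiberPart ω) := by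
  funext n x
  change ∑ Γ : MaxChain n (r + 1), Γ.integrate (restrict ω x Γ) =
    ∑ Γ : MaxChain n r, Γ.integrate (restrict (fiberPart ω) x Γ)
  let G : MaxChain n r → Fin (n + r + 1) → Omega n := fun Γ i =>
    if h : Γ.toFiber.toOrderHom i = 0 then
      (Γ.insertStep i h).integrate (restrict ω x (Γ.insertStep i h)) else 0
  have h1 : ∀ Γ : MaxChain n r, Γ.integrate (restrict (fiberPart ω) x Γ) = ∑ i, G Γ i := by
    intro Γ
    rw [restrict_eq, fiberPart_apply, map_sum]
    refine Finset.sum_congr rfl fun i _ => ?_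
    by_cases hi : Γ.toFiber.toOrderHom i = 0
    · rw [if_pos hi]
      refine Eq.trans ?_ (dif_pos hi).symm
      rw [MaxChain.integrate_insertStep, restrict_eq, map_comp_apply']
      rfl
    · rw [if_neg hi, map_zero]
      exact (dif_neg hi : G Γ i = 0).symm
  rw [Finset.sum_congr rfl fun Γ _ => h1 Γ, ← Fintype.sum_prod_type']
  refine Fintype.sum_of_injective (fun Γ => (Γ.removeStep, Γ.lastBottom)) ?_ _ _ ?_ ?_
  · intro Γ Γ' h
    have ha := congrArg Prod.fst h
    have hb := congrArg Prod.snd h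
    simp only at ha hb
    rw [← Γ.insertStep_removeStep, ← Γ'.insertStep_removeStep]
    simp only [ha, hb]
  · rintro ⟨Γ, i⟩ h
    refine dif_neg fun hi => h ⟨Γ.insertStep i hi, ?_⟩
    exact Prod.ext (Γ.removeStep_insertStep i hi) (Γ.lastBottom_insertStep i hi)
  · intro Γ
    refine Eq.trans ?_ (dif_pos Γ.toFiber_removeStep_lastBottom).symm
    rw [Γ.insertStep_removeStep]

end FiberIntegral

/-! ### Stokes' formula -/

section Stokes

variable {X Y : SSet.{u}} {n r : ℕ}

/-- Fiberwise integration as an additive map. -/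
def fiberIntegralHom (X : SSet.{u}) (r : ℕ) : Family (X ⊗ (Δ[r] : SSet.{u})) →+ Family X :=
  AddMonoidHom.mk' (fiberIntegral r) fun ω η => by
    funext n x
    change ∑ Γ : MaxChain n r, Γ.integrate (restrict (ω + η) x Γ) =
      ∑ Γ : MaxChain n r, Γ.integrate (restrict ω x Γ) +
        ∑ Γ : MaxChain n r, Γ.integrate (restrict η x Γ)
    rw [← Finset.sum_add_distrib]
    exact Finset.sum_congr rfl fun Γ _ => map_add Γ.integrate _ _

theorem fiberIntegral_eq (ω : Family (X ⊗ (Δ[r] : SSet.{u}))) :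
    fiberIntegral r ω = fiberIntegralHom X r ω := rfl

/-- The isomorphism `X ≅ X × Δ^0`. -/
def toProd (X : SSet.{u}) : X ⟶ X ⊗ (Δ[0] : SSet.{u}) :=
  CartesianMonoidalCategory.lift (𝟙 X) (SSet.stdSimplex.isTerminalObj₀.from X)

theorem toProd_app (x : X _⦋n⦌) (α : ⦋n⦌ ⟶ ⦋0⦌) :
    (toProd X).app (op ⦋n⦌) x = pairSimplex x α := by
  refine Prod.ext rfl (SSet.stdSimplex.objEquiv.injective (hom_ext' fun j => ?_))
  have h (β : ⦋n⦌ ⟶ ⦋0⦌) : ((β.toOrderHom j : Fin 1) : ℕ) = 0 :=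
    Nat.lt_one_iff.1 (β.toOrderHom j).2
  rw [h, h]

theorem MaxChain.toBase_zero (Γ : MaxChain n 0) : Γ.toBase = 𝟙 ⦋n⦌ := by
  refine hom_ext' fun j => ?_
  have := Γ.add_eq j
  change ((Γ j).1 : ℕ) = j
  omega

theorem MaxChain.integrate_zero (Γ : MaxChain n 0) (η : Omega n) : Γ.integrate η = η := by
  have hb : Γ.base = 𝟙 ⦋n⦌ := by
    refine hom_ext' fun j => ?_
    rw [MaxChain.val_base, Γ.toBase_zero]
    exact leastIndex_id _ (by omega)
  rw [MaxChain.integrate_apply, composeList_zero, hb]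
  exact pull_id η

theorem fiberIntegral_zero (ω : Family (X ⊗ (Δ[0] : SSet.{u}))) :
    fiberIntegral 0 ω = pullback (toProd X) ω := by
  funext n x
  have hf : ∀ Γ Γ' : MaxChain n 0, Γ = Γ' := fun Γ Γ' =>
    MaxChain.ext_toFiber (hom_ext' fun j => by
      exact (Nat.lt_one_iff.1 (Γ j).2.2).trans (Nat.lt_one_iff.1 (Γ' j).2.2).symm)
  let Γ₀ : MaxChain n 0 := MaxChain.mk (𝟙 ⦋n⦌) (SimplexCategory.const _ _ 0) fun j => rfl
  change ∑ Γ : MaxChain n 0, Γ.integrate (restrict ω x Γ) = ω n ((toProd X).app (op ⦋n⦌) x)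
  rw [Finset.sum_eq_single Γ₀ (fun Γ _ h => absurd (hf Γ Γ₀) h)
    fun h => absurd (Finset.mem_univ _) h]
  refine (Γ₀.integrate_zero _).trans ?_
  rw [toProd_app x Γ₀.toFiber, restrict_eq, Γ₀.toBase_zero]
  exact congrArg (fun y => ω n (pairSimplex y Γ₀.toFiber)) (map_id_apply' x)

theorem IsForm.fiberIntegral {ω : Family (X ⊗ (Δ[r] : SSet.{u}))} (hω : IsForm ω) :
    IsForm (fiberIntegral r ω) := by
  induction r with
  | zero => rw [fiberIntegral_zero]; exact hω.pullback _
  | succ r ih => rw [fiberIntegral_succ]; exact ih hω.fiberPart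

/-- Stokes' formula for fiberwise integration along `X × Δ^{r+1} → X`. -/
theorem d_fiberIntegral {ω : Family (X ⊗ (Δ[r + 1] : SSet.{u}))} (hω : IsForm ω) :
    d (fiberIntegral (r + 1) ω) = (-1 : ℤ) ^ (r + 1) • fiberIntegral (r + 1) (d ω) +
      ∑ s : Fin (r + 2), (-1 : ℤ) ^ (r + (s : ℕ)) • fiberIntegral r (facePull s ω) := by
  induction r with
  | zero =>
    rw [fiberIntegral_succ, fiberIntegral_succ, fiberIntegral_zero]
    change pullback _ (d (fiberPart ω)) = _
    rw [← fiberIntegral_zero, d_fiberPart hω, Fin.sum_univ_two]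
    simp only [fiberIntegral_eq, map_sub]
    simp
    abel
  | succ r ih =>
    rw [fiberIntegral_succ, ih hω.fiberPart, d_fiberPart hω, Fin.sum_univ_succ,
      facePull_zero_fiberPart, Fin.sum_univ_succ (n := r + 2), Fin.sum_univ_succ (n := r + 1)]
    simp only [facePull_succ_fiberPart, ← fiberIntegral_succ]
    simp only [fiberIntegral_eq, map_sub, map_zero, smul_sub, smul_zero, zero_add]
    rw [← fiberIntegral_eq, ← fiberIntegral_eq (fiberPart (d ω)), ← fiberIntegral_succ]
    have h1 : ∀ k : Fin (r + 1), (-1 : ℤ) ^ (r + (k.succ : ℕ)) =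
        (-1) ^ (r + 1 + (k.succ.succ : ℕ)) := fun k => by
      rw [Fin.val_succ k.succ]
      ring
    simp only [h1, fiberIntegral_eq]
    have h2 : ((Fin.succ 0 : Fin (r + 3)) : ℕ) = 1 := rfl
    rw [h2, Fin.succ_zero_eq_one, Fin.val_zero, add_zero, pow_succ _ (r + 1), mul_neg_one, neg_smul,
      neg_smul]
    abel

theorem fiberIntegral_mul_pullback (ω : Family (X ⊗ (Δ[r] : SSet.{u}))) {γ : Family X}
    (hγ : IsForm γ) :
    fiberIntegral r (ω * pullback (CartesianMonoidalCategory.fst _ _) γ) =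
      fiberIntegral r ω * γ := by
  induction r with
  | zero => rw [fiberIntegral_zero, fiberIntegral_zero]; rfl
  | succ r ih =>
    rw [fiberIntegral_succ, fiberIntegral_succ, fiberPart_mul_pullback _ hγ, ih]

theorem fiberIntegral_pullback_mul (ω : Family (X ⊗ (Δ[r] : SSet.{u}))) {γ : Family X}
    (hγ : IsForm γ) {p : ℕ} (hp : IsHomogeneous p γ) :
    fiberIntegral r (pullback (CartesianMonoidalCategory.fst _ _) γ * ω) =
      (-1 : ℤ) ^ (r * p) • (γ * fiberIntegral r ω) := by
  induction r with
  | zero => rw [fiberIntegral_zero, fiberIntegral_zero, zero_mul, pow_zero, one_smul]; rfl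
  | succ r ih =>
    rw [fiberIntegral_succ, fiberIntegral_succ, fiberPart_pullback_mul _ hγ hp, fiberIntegral_eq,
      map_zsmul, ← fiberIntegral_eq, ih, smul_smul]
    ring_nf

end Stokes

/-! ### Products of forms -/

section Products

variable {X Y : SSet.{u}}

/-- The pullback of families as a multiplicative map. -/
def pullbackHom (f : X ⟶ Y) : Family Y →* Family X where
  toFun := pullback f
  map_one' := rfl
  map_mul' _ _ := rfl

theorem pullback_list_prod {r : ℕ} (f : X ⟶ Y) (g : Fin r → Family Y) :
    pullback f (List.ofFn g).prod = (List.ofFn fun j => pullback f (g j)).prod := by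
  have h := map_list_prod (pullbackHom f) (List.ofFn g)
  rw [List.map_ofFn] at h
  exact h

theorem isForm_list_prod {r : ℕ} {g : Fin r → Family X} (hg : ∀ j, IsForm (g j)) :
    IsForm (List.ofFn g).prod := by
  induction r with
  | zero => rw [List.ofFn_zero]; exact isForm_one
  | succ r ih => rw [List.ofFn_succ, List.prod_cons]; exact (hg 0).mul (ih fun j => hg j.succ)

theorem d_mul {p : ℕ} {ω : Family X} (hω : IsHomogeneous p ω) (η : Family X) :
    d (ω * η) = d ω * η + (-1 : ℤ) ^ p • (ω * d η) := by
  funext n x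
  exact dOmega_mul (hω n x) (η n x)

theorem sum_Iio_succ {r : ℕ} (p : Fin (r + 1) → ℕ) (i : Fin r) :
    ∑ j ∈ Finset.Iio i.succ, p j = p 0 + ∑ j ∈ Finset.Iio i, p j.succ := by
  have h : ∀ {r : ℕ} (p : Fin r → ℕ) (i : Fin r),
      ∑ j ∈ Finset.Iio i, p j = ∑ j, if j < i then p j else 0 := fun p i => by
    rw [← Finset.sum_filter]
    congr 1
    ext j
    simp
  rw [h, h, Fin.sum_univ_succ]
  simp

/-- The graded Leibniz rule for products of several forms. -/
theorem d_list_prod {r : ℕ} {g : Fin r → Family X} {p : Fin r → ℕ}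
    (hg : ∀ j, IsHomogeneous (p j) (g j)) :
    d (List.ofFn g).prod = ∑ i, (-1 : ℤ) ^ (∑ j ∈ Finset.Iio i, p j) •
      (List.ofFn (Function.update g i (d (g i)))).prod := by
  induction r with
  | zero =>
    rw [List.ofFn_zero, Fin.sum_univ_zero]
    funext n x
    exact dOmega_one
  | succ r ih =>
    rw [List.ofFn_succ, List.prod_cons, d_mul (hg 0), ih fun j => hg j.succ, Fin.sum_univ_succ,
      Finset.mul_sum, Finset.smul_sum]
    congr 1
    · rw [List.ofFn_succ, List.prod_cons, Function.update_self]
      have h : Finset.Iio (0 : Fin (r + 1)) = ∅ := by ext j; simp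
      rw [h, Finset.sum_empty, pow_zero, one_smul]
      congr 3
    · refine Finset.sum_congr rfl fun i _ => ?_
      rw [sum_Iio_succ, List.ofFn_succ, List.prod_cons,
        Function.update_of_ne (Fin.succ_ne_zero i).symm, pow_add, mul_smul, mul_smul_comm]
      congr 5
      funext j
      by_cases hj : j = i
      · subst hj
        rw [Function.update_self, Function.update_self]
      · rw [Function.update_of_ne hj, Function.update_of_ne fun h => hj (Fin.succ_injective _ h)]

/-- Multiplying two neighbours does not change the product of a list. -/
theorem prod_ofFn_contractNth {M : Type*} [Monoid M] {r : ℕ} (g : Fin (r + 1) → M) (i : Fin r) :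
    (List.ofFn (Fin.contractNth i.castSucc (fun a b => a * b) g)).prod = (List.ofFn g).prod := by
  induction r with
  | zero => exact i.elim0
  | succ r ih =>
    rw [List.ofFn_succ, List.prod_cons, List.ofFn_succ (f := g), List.prod_cons]
    rcases Fin.eq_zero_or_eq_succ i with rfl | ⟨i, rfl⟩
    · rw [List.ofFn_succ (f := fun j => g j.succ), List.prod_cons, ← mul_assoc]
      congr 1
    · have h1 : Fin.contractNth i.succ.castSucc (fun a b => a * b) g 0 = g 0 :=
        Fin.contractNth_apply_of_lt _ _ _ _ (by simp)
      rw [h1, ← ih (fun j => g j.succ) i]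
      congr 3
      funext k
      unfold Fin.contractNth
      simp only [Fin.val_succ, Fin.val_castSucc, Fin.castSucc_succ, add_lt_add_iff_right,
        add_left_inj]

end Products

/-! ### Iterated integrals -/

section Iterated

variable {X : SSet.{u}} {r : ℕ}

/-- The composite `X^{Δ^1} × Δ^r → X^{Δ^1} × Δ^1 → X` of `κ : [r] → [1]` and the evaluation. -/
def evalAlong (X : SSet.{u}) (κ : ⦋r⦌ ⟶ ⦋1⦌) : pathSpace X ⊗ (Δ[r] : SSet.{u}) ⟶ X :=
  CartesianMonoidalCategory.lift
      (CartesianMonoidalCategory.snd _ _ ≫ SSet.stdSimplex.map κ)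
      (CartesianMonoidalCategory.fst _ _) ≫
    (ihom.ev (Δ[1] : SSet.{u})).app X

theorem phi_eq (j : Fin r) : phi X j = evalAlong X (iotaHom j) := rfl

theorem stdSimplex_map_comp {l m n : ℕ} (α : ⦋l⦌ ⟶ ⦋m⦌) (β : ⦋m⦌ ⟶ ⦋n⦌) :
    SSet.stdSimplex.{u}.map (α ≫ β) = SSet.stdSimplex.map α ≫ SSet.stdSimplex.map β :=
  CategoryTheory.Functor.map_comp _ _ _

/-- Evaluating along a constant map `[r] → [1]` is evaluating at a vertex. -/
theorem evalAlong_const (ε : Fin 2) (κ : ⦋r⦌ ⟶ ⦋1⦌) (hκ : ∀ j, κ.toOrderHom j = ε) :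
    evalAlong X κ = CartesianMonoidalCategory.fst _ _ ≫ evalAt X ε := by
  have h1 : κ = SimplexCategory.const ⦋r⦌ ⦋0⦌ 0 ≫ SimplexCategory.const ⦋0⦌ ⦋1⦌ ε :=
    hom_ext' fun j => congrArg Fin.val (hκ j)
  have h2 : (MonoidalClosed.pre (SSet.stdSimplex.{u}.map (SimplexCategory.const ⦋0⦌ ⦋1⦌ ε))).app X ≫
      CartesianMonoidalCategory.lift (SSet.stdSimplex.isTerminalObj₀.from _) (𝟙 _) =
      CartesianMonoidalCategory.lift (SSet.stdSimplex.isTerminalObj₀.from _) (𝟙 _) ≫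
        (Δ[0] : SSet.{u}) ◁ (MonoidalClosed.pre
          (SSet.stdSimplex.{u}.map (SimplexCategory.const ⦋0⦌ ⦋1⦌ ε))).app X := by
    rw [CartesianMonoidalCategory.comp_lift, CartesianMonoidalCategory.lift_whiskerLeft]
    congr 1
  rw [evalAt, ← Category.assoc ((MonoidalClosed.pre _).app X), h2, Category.assoc,
    MonoidalClosed.id_tensor_pre_app_comp_ev, ← Category.assoc (CartesianMonoidalCategory.lift _ _),
    CartesianMonoidalCategory.lift_whiskerRight, ← Category.assoc,
    CartesianMonoidalCategory.comp_lift, evalAlong, h1, stdSimplex_map_comp, Category.comp_id,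
    ← Category.assoc, ← Category.assoc]
  congr 3

theorem iotaHom_apply (j : Fin r) (i : Fin (r + 1)) :
    (iotaHom j).toOrderHom i = if (j : ℕ) < i then (1 : Fin 2) else 0 := rfl

theorem δ_comp_iotaHom_apply (s : Fin (r + 2)) (j : Fin (r + 1)) (i : Fin (r + 1)) :
    (SimplexCategory.δ s ≫ iotaHom j).toOrderHom i =
      if (j : ℕ) < (if (i : ℕ) < s then (i : ℕ) else i + 1) then (1 : Fin 2) else 0 := by
  rw [comp_apply', iotaHom_apply, δ_apply]

theorem δ_comp_iotaHom_castSucc (s : Fin (r + 2)) (j : Fin r) (h : (j : ℕ) < s) :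
    SimplexCategory.δ s ≫ iotaHom j.castSucc = iotaHom j := by
  refine hom_ext' fun i => congrArg Fin.val ?_
  rw [δ_comp_iotaHom_apply, iotaHom_apply, Fin.val_castSucc]
  congr 1
  split_ifs <;> exact propext (by omega)

theorem δ_comp_iotaHom_succ (s : Fin (r + 2)) (j : Fin r) (h : (s : ℕ) ≤ j + 1) :
    SimplexCategory.δ s ≫ iotaHom j.succ = iotaHom j := by
  refine hom_ext' fun i => congrArg Fin.val ?_
  rw [δ_comp_iotaHom_apply, iotaHom_apply, Fin.val_succ]
  congr 1
  split_ifs <;> exact propext (by omega)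

theorem facePull_timesForm (s : Fin (r + 2)) (ω : Fin (r + 1) → Family X) :
    facePull s (timesForm ω) =
      (List.ofFn fun j => pullback (evalAlong X (SimplexCategory.δ s ≫ iotaHom j)) (ω j)).prod := by
  rw [timesForm, facePull, pullback_list_prod]
  congr 2

/-- On the face `t_1 = ϑ`, the first form is evaluated at the end point of the path. -/
theorem facePull_zero_timesForm (ω : Fin (r + 1) → Family X) :
    facePull 0 (timesForm ω) =
      pullback (CartesianMonoidalCategory.fst _ _) (pullback (evalAt X 1) (ω 0)) *
        timesForm (Fin.tail ω) := by
  rw [facePull_timesForm, List.ofFn_succ, List.prod_cons, evalAlong_const 1, timesForm]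
  · have h : ∀ j : Fin r, SimplexCategory.δ 0 ≫ iotaHom j.succ = iotaHom j := fun j =>
      δ_comp_iotaHom_succ 0 j (by simp)
    simp only [h]
    rfl
  · intro i
    rw [δ_comp_iotaHom_apply]
    simp

/-- On the face `t_{r+1} = 0`, the last form is evaluated at the starting point of the path. -/
theorem facePull_last_timesForm (ω : Fin (r + 1) → Family X) :
    facePull (Fin.last (r + 1)) (timesForm ω) = timesForm (Fin.init ω) *
      pullback (CartesianMonoidalCategory.fst _ _) (pullback (evalAt X 0) (ω (Fin.last r))) := by
  rw [facePull_timesForm, List.ofFn_succ', List.concat_eq_append, List.prod_append,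
    List.prod_singleton, evalAlong_const 0, timesForm]
  · have h : ∀ j : Fin r, SimplexCategory.δ (Fin.last (r + 1)) ≫ iotaHom j.castSucc =
      iotaHom j := fun j => δ_comp_iotaHom_castSucc _ j (by rw [Fin.val_last]; omega)
    simp only [h]
    rfl
  · intro i
    rw [δ_comp_iotaHom_apply]
    have : (i : ℕ) < r + 1 := i.2
    rw [Fin.val_last, Fin.val_last, if_pos this, if_neg (by omega)]

/-- On the face `t_{i+1} = t_{i+2}`, two neighbouring forms are evaluated at the same point. -/
theorem facePull_castSucc_succ_timesForm (ω : Fin (r + 1) → Family X) (i : Fin r) :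
    facePull i.castSucc.succ (timesForm ω) =
      timesForm (Fin.contractNth i.castSucc (fun a b => a * b) ω) := by
  rw [facePull_timesForm, timesForm, ← prod_ofFn_contractNth _ i]
  congr 2
  funext k
  rw [phi_eq]
  rcases lt_trichotomy (k : ℕ) i with h | h | h
  · rw [Fin.contractNth_apply_of_lt _ _ _ _ h, Fin.contractNth_apply_of_lt _ _ _ _ h,
      δ_comp_iotaHom_castSucc _ _ (by simp; omega)]
  · rw [Fin.contractNth_apply_of_eq _ _ _ _ h, Fin.contractNth_apply_of_eq _ _ _ _ h,
      δ_comp_iotaHom_castSucc _ _ (by simp; omega), δ_comp_iotaHom_succ _ _ (by simp; omega)]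
    rfl
  · rw [Fin.contractNth_apply_of_gt _ _ _ _ h, Fin.contractNth_apply_of_gt _ _ _ _ h,
      δ_comp_iotaHom_succ _ _ (by simp; omega)]

theorem isForm_timesForm {ω : Fin r → Family X} (hω : ∀ i, IsForm (ω i)) :
    IsForm (timesForm ω) :=
  isForm_list_prod fun j => (hω j).pullback _

theorem d_timesForm {ω : Fin r → Family X} {p : Fin r → ℕ}
    (hp : ∀ i, IsHomogeneous (p i) (ω i)) :
    d (timesForm ω) = ∑ i, (-1 : ℤ) ^ (∑ j ∈ Finset.Iio i, p j) •
      timesForm (Function.update ω i (d (ω i))) := by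
  rw [timesForm, d_list_prod fun j => (hp j).pullback _]
  refine Finset.sum_congr rfl fun i _ => ?_
  rw [timesForm]
  congr 3
  funext j
  by_cases hj : j = i
  · subst hj
    rw [Function.update_self, Function.update_self]
    rfl
  · rw [Function.update_of_ne hj, Function.update_of_ne hj]

/-- Signs with integral exponents only depend on the parity of the exponent. -/
theorem negOnePow_smul {M : Type*} [AddCommGroup M] {z : ℤ} {k : ℕ} (h : Even (z - k)) (x : M) :
    (z.negOnePow : ℤˣ) • x = (-1 : ℤ) ^ k • x := by
  rw [(Int.negOnePow_eq_iff z k).2 h, Units.smul_def, Int.coe_negOnePow_natCast]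

end Iterated

end SimplicialForms

end
open SimplicialForms in
theorem mainTheorem5 {X : SSet.{u}} (s : ℕ) (ω : Fin (s + 1) → Family X) (p : Fin (s + 1) → ℕ)
    (hω : ∀ i, IsForm (ω i)) (hp : ∀ i, IsHomogeneous (p i) (ω i)) :
    IsForm (iteratedIntegral ω) ∧
    d (iteratedIntegral ω) =
      (∑ i : Fin (s + 1),
        (((∑ j ∈ Finset.Iio i, (p j : ℤ)) + (s + 1)).negOnePow : ℤˣ) •
          iteratedIntegral (Function.update ω i (d (ω i))))
      + (∑ i : Fin s,
        (((s + 1 : ℤ) - 1 - ((i : ℕ) + 1)).negOnePow : ℤˣ) •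
          iteratedIntegral (Fin.contractNth i.castSucc (fun a b => a * b) ω))
      + (((s : ℤ) * ((p 0 : ℤ) - 1)).negOnePow : ℤˣ) •
          (pullback (evalAt X 1) (ω 0) * iteratedIntegral (Fin.tail ω))
      - iteratedIntegral (Fin.init ω) * pullback (evalAt X 0) (ω (Fin.last s)) := by
  have hF := isForm_timesForm hω
  refine ⟨hF.fiberIntegral, ?_⟩
  -- The interior term of Stokes' formula, by the Leibniz rule.
  have hinner : (-1 : ℤ) ^ (s + 1) • fiberIntegral (s + 1) (d (timesForm ω)) =
      ∑ i : Fin (s + 1), (((∑ j ∈ Finset.Iio i, (p j : ℤ)) + (s + 1)).negOnePow : ℤˣ) •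
        iteratedIntegral (Function.update ω i (d (ω i))) := by
    rw [d_timesForm hp, fiberIntegral_eq, map_sum, Finset.smul_sum]
    refine Finset.sum_congr rfl fun i _ => ?_
    rw [map_zsmul, smul_smul, ← pow_add, ← fiberIntegral_eq]
    refine (negOnePow_smul ?_ _).symm
    push_cast
    rw [add_comm, sub_self]
    exact Even.zero
  -- The face `t_1 = ϑ`. Moving `E_1^* ω_0` across the `s` fiber variables costs `(-1)^(s p_0)`.
  have hfirst : (-1 : ℤ) ^ (s + ((0 : Fin (s + 2)) : ℕ)) •
      fiberIntegral s (facePull 0 (timesForm ω)) =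
      (((s : ℤ) * ((p 0 : ℤ) - 1)).negOnePow : ℤˣ) •
        (pullback (evalAt X 1) (ω 0) * iteratedIntegral (Fin.tail ω)) := by
    rw [facePull_zero_timesForm, fiberIntegral_pullback_mul _ ((hω 0).pullback _)
      ((hp 0).pullback _), smul_smul, ← pow_add]
    refine (negOnePow_smul ⟨-(s : ℤ), ?_⟩ _).symm
    push_cast
    simp
    ring
  -- The face on which the last fiber variable vanishes; its sign is `(-1)^(2 s + 1)`.
  have hlast : (-1 : ℤ) ^ (s + ((Fin.last (s + 1) : Fin (s + 2)) : ℕ)) •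
      fiberIntegral s (facePull (Fin.last (s + 1)) (timesForm ω)) =
      -(iteratedIntegral (Fin.init ω) * pullback (evalAt X 0) (ω (Fin.last s))) := by
    rw [facePull_last_timesForm, fiberIntegral_mul_pullback _ ((hω _).pullback _), Fin.val_last,
      Odd.neg_one_pow ⟨s, by omega⟩, neg_one_smul]
    rfl
  -- The faces on which two neighbouring fiber variables agree.
  have hmiddle : ∀ i : Fin s, (-1 : ℤ) ^ (s + ((i.castSucc.succ : Fin (s + 2)) : ℕ)) •
      fiberIntegral s (facePull i.castSucc.succ (timesForm ω)) =
      (((s + 1 : ℤ) - 1 - ((i : ℕ) + 1)).negOnePow : ℤˣ) •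
        iteratedIntegral (Fin.contractNth i.castSucc (fun a b => a * b) ω) := by
    intro i
    rw [facePull_castSucc_succ_timesForm]
    refine (negOnePow_smul ⟨-((i : ℤ) + 1), ?_⟩ _).symm
    rw [Fin.val_succ, Fin.val_castSucc]
    push_cast
    ring
  have hfaces := Fin.sum_univ_succ fun σ : Fin (s + 2) =>
    (-1 : ℤ) ^ (s + (σ : ℕ)) • fiberIntegral s (facePull σ (timesForm ω))
  rw [Fin.sum_univ_castSucc (n := s), Fin.succ_last, hlast, hfirst,
    Finset.sum_congr rfl fun i _ => hmiddle i] at hfaces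
  rw [iteratedIntegral, d_fiberIntegral hF, hinner, hfaces]
  abel
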